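/- Let $\mathcal R$ be the $N=1$ Ramond algebra, i.e. the complex Lie superalgebra with basis $\{L_m,G_m,C\mid m\in\mathbb Z\}$, where the $L_m$ and $C$ are even and the $G_m$ are odd, $C$ is central, and for all $m,n\in\mathbb Z$ $$[L_m,L_n]=(n-m)L_{m+n}+\frac{m^3-m}{12}\,\delta_{m+n,0}\,C,$$ $$[G_m,G_n]=-2L_{m+n}+\frac{4m^2-1}{12}\,\delta_{m+n,0}\,C,$$ $$[L_m,G_n]=\Bigl(n-\frac m2\Bigr)G_{m+n}.$$ Let $\mathcal B$ be the subalgebra of $\mathcal R$ spanned by $L_m$ $(m\ge 0)$, $G_m$ $(m\ge 1)$ and $C$. All modules are $\mathbb Z/2$-graded: a module over a Lie superalgebra $\mathfrak g$ is a complex vector space $M=M_{\bar 0}\oplus M_{\bar 1}$ with a bilinear action satisfying $\mathfrak g_{\bar i}M_{\bar j}\subseteq M_{\bar i+\bar j}$ and $x(yv)-(-1)^{|x||y|}y(xv)=[x,y]v$ for homogeneous $x,y\in\mathfrak g$ and $v\in M$; it is simple if it is nonzero and has no graded submodules other than $0$ and itself. Write $U(\mathfrak g)$ for the universal enveloping algebra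 of $\mathfrak g$. **Theorem.** Let $c\in\mathbb C$ and let $r\ge 2$ be an integer. Let $V$ be a simple $\mathcal B$-module on which $C$ acts as the scalar $c$, such that 1. $L_r$ acts injectively on $V$; 2. $L_mV=0$ for all $m>r$, and $G_rV=0$. Then the induced $\mathcal R$-module $$\mathrm{Ind}_{\mathcal B,c}(V)=U(\mathcal R)\otimes_{U(\mathcal B)}V,$$ with the $\mathbb Z/2$-grading induced by those of $U(\mathcal R)$ and $V$, is simple. -/

import Mathlib

open scoped TensorProduct

noncomputable section

namespace SuperLie

/-- The sign `(-1)^(i*j)` of two parities. -/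
def koszul (i j : ZMod 2) : ℂ := if i = 1 ∧ j = 1 then -1 else 1

/-- A `ℤ/2`-graded complex vector space `M = M_0 ⊕ M_1`. -/
class SuperSpace (M : Type*) [AddCommGroup M] [Module ℂ M] where
  part : ZMod 2 → Submodule ℂ M
  isCompl : IsCompl (part 0) (part 1)

open SuperSpace (part)

/-- A subspace `N` is graded if `N = (N ∩ M_0) + (N ∩ M_1)`. -/
def IsGraded {M : Type*} [AddCommGroup M] [Module ℂ M] [SuperSpace M]
    (N : Submodule ℂ M) : Prop :=
  N ≤ (N ⊓ part 0) ⊔ (N ⊓ part 1)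

/-- Lie superalgebras over `ℂ`: a graded bilinear bracket which is super skew-symmetric and
satisfies the super Jacobi identity. -/
class LieSuperalgebra (𝔤 : Type*) [AddCommGroup 𝔤] [Module ℂ 𝔤] [SuperSpace 𝔤] where
  bracket : 𝔤 →ₗ[ℂ] 𝔤 →ₗ[ℂ] 𝔤
  br_mem : ∀ (i j : ZMod 2) (x y : 𝔤), x ∈ part i → y ∈ part j → bracket x y ∈ part (i + j)
  br_skew : ∀ (i j : ZMod 2) (x y : 𝔤), x ∈ part i → y ∈ part j →
    bracket x y = -(koszul i j • bracket y x)
  br_jacobi : ∀ (i j : ZMod 2) (x y z : 𝔤), x ∈ part i → y ∈ part j →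
    bracket x (bracket y z) = bracket (bracket x y) z + koszul i j • bracket y (bracket x z)

/-- The super bracket. -/
abbrev br {𝔤 : Type*} [AddCommGroup 𝔤] [Module ℂ 𝔤] [SuperSpace 𝔤] [LieSuperalgebra 𝔤] :
    𝔤 →ₗ[ℂ] 𝔤 →ₗ[ℂ] 𝔤 :=
  LieSuperalgebra.bracket

/-- Modules over a Lie superalgebra: `ℤ/2`-graded spaces with a graded bilinear action such that
`x (y v) - (-1)^{|x||y|} y (x v) = [x, y] v` for homogeneous `x`, `y`. -/
class LieSupermodule (𝔤 M : Type*) [AddCommGroup 𝔤] [Module ℂ 𝔤] [SuperSpace 𝔤]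
    [LieSuperalgebra 𝔤] [AddCommGroup M] [Module ℂ M] [SuperSpace M] where
  action : 𝔤 →ₗ[ℂ] M →ₗ[ℂ] M
  act_mem : ∀ (i j : ZMod 2) (x : 𝔤) (v : M), x ∈ part i → v ∈ part j → action x v ∈ part (i + j)
  act_br : ∀ (i j : ZMod 2) (x y : 𝔤) (v : M), x ∈ part i → y ∈ part j →
    action x (action y v) - koszul i j • action y (action x v) = action (br x y) v

/-- The action of a Lie superalgebra on a module. -/
abbrev act {𝔤 M : Type*} [AddCommGroup 𝔤] [Module ℂ 𝔤] [SuperSpace 𝔤] [LieSuperalgebra 𝔤]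
    [AddCommGroup M] [Module ℂ M] [SuperSpace M] [LieSupermodule 𝔤 M] : 𝔤 →ₗ[ℂ] M →ₗ[ℂ] M :=
  LieSupermodule.action

/-- A module is simple if it is nonzero and its only (graded) submodules are `0` and itself. -/
def IsSimple (𝔤 M : Type*) [AddCommGroup 𝔤] [Module ℂ 𝔤] [SuperSpace 𝔤]
    [LieSuperalgebra 𝔤] [AddCommGroup M] [Module ℂ M] [SuperSpace M] [LieSupermodule 𝔤 M] :
    Prop :=
  Nontrivial M ∧ ∀ N : Submodule ℂ M, IsGraded N → (∀ (x : 𝔤) (v : M), v ∈ N → act x v ∈ N) →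
    N = ⊥ ∨ N = ⊤

/-! ### The parity involution (used only to prove that gradings are direct sums) -/

/-- The sign `(-1)^i`. -/
def sgn (i : ZMod 2) : ℂ := if i = 0 then 1 else -1

theorem zmod2_cases (i : ZMod 2) : i = 0 ∨ i = 1 := by
  revert i; decide

theorem sgn_add (i j : ZMod 2) : sgn (i + j) = sgn i * sgn j := by
  have e : (1 + 1 : ZMod 2) = 0 := rfl
  rcases zmod2_cases i with rfl | rfl <;> rcases zmod2_cases j with rfl | rfl <;> simp [sgn, e]

section parity
variable {M : Type*} [AddCommGroup M] [Module ℂ M] [SuperSpace M]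

theorem exists_parts (v : M) : ∃ a ∈ part (M := M) 0, ∃ b ∈ part (M := M) 1, a + b = v :=
  Submodule.mem_sup.1 (((SuperSpace.isCompl (M := M)).sup_eq_top).symm ▸ Submodule.mem_top)

def parity (M : Type*) [AddCommGroup M] [Module ℂ M] [SuperSpace M] : M →ₗ[ℂ] M :=
  Submodule.projection _ _ (SuperSpace.isCompl (M := M)) -
    Submodule.projection _ _ (SuperSpace.isCompl (M := M)).symm

theorem parity_apply {i : ZMod 2} {v : M} (hv : v ∈ part i) : parity M v = sgn i • v := by
  rcases zmod2_cases i with rfl | rfl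
  · have h1 := Submodule.projection_apply_of_mem_left (SuperSpace.isCompl (M := M)) hv
    have h2 := Submodule.projection_apply_of_mem_right
      (SuperSpace.isCompl (M := M)).symm hv
    simp [parity, sgn, h1, h2]
  · have h1 := Submodule.projection_apply_of_mem_right (SuperSpace.isCompl (M := M)) hv
    have h2 := Submodule.projection_apply_of_mem_left
      (SuperSpace.isCompl (M := M)).symm hv
    simp [parity, sgn, h1, h2]

end parity

theorem disjoint_of_involution {M : Type*} [AddCommGroup M] [Module ℂ M] (σ : M →ₗ[ℂ] M)
    (A B : Submodule ℂ M) (hA : ∀ v ∈ A, σ v = v) (hB : ∀ v ∈ B, σ v = -v) : Disjoint A B := by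
  rw [Submodule.disjoint_def]
  intro v h1 h2
  have h : v = -v := (hA v h1).symm.trans (hB v h2)
  have h3 : (2 : ℂ) • v = 0 := by
    rw [two_smul]; nth_rewrite 1 [h]; simp
  simpa using h3

/-! ### Subalgebras -/

/-- A (graded) subalgebra of a Lie superalgebra. -/
structure Subalg (𝔤 : Type*) [AddCommGroup 𝔤] [Module ℂ 𝔤] [SuperSpace 𝔤]
    [LieSuperalgebra 𝔤] where
  space : Submodule ℂ 𝔤
  graded : IsGraded space
  br_mem : ∀ x ∈ space, ∀ y ∈ space, br x y ∈ space

section general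
variable {𝔤 : Type*} [AddCommGroup 𝔤] [Module ℂ 𝔤] [SuperSpace 𝔤] [LieSuperalgebra 𝔤]

instance (𝔟 : Subalg 𝔤) : SuperSpace 𝔟.space where
  part i := (part i).comap 𝔟.space.subtype
  isCompl := by
    constructor
    · rw [Submodule.disjoint_def]
      intro x h0 h1
      exact Subtype.ext ((Submodule.disjoint_def.1 SuperSpace.isCompl.disjoint) _ h0 h1)
    · rw [codisjoint_iff, eq_top_iff]
      rintro ⟨x, hx⟩ -
      obtain ⟨a, ha, b, hb, h⟩ := Submodule.mem_sup.1 (𝔟.graded hx)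
      exact Submodule.mem_sup.2 ⟨⟨a, ha.1⟩, ha.2, ⟨b, hb.1⟩, hb.2, Subtype.ext h⟩

instance (𝔟 : Subalg 𝔤) : LieSuperalgebra 𝔟.space where
  bracket := LinearMap.mk₂ ℂ (fun x y => ⟨br (x : 𝔤) (y : 𝔤), 𝔟.br_mem _ x.2 _ y.2⟩)
    (fun _ _ _ => Subtype.ext (by simp)) (fun _ _ _ => Subtype.ext (by simp))
    (fun _ _ _ => Subtype.ext (by simp)) (fun _ _ _ => Subtype.ext (by simp))
  br_mem i j x y hx hy := LieSuperalgebra.br_mem i j (x : 𝔤) (y : 𝔤) hx hy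
  br_skew i j x y hx hy := Subtype.ext (LieSuperalgebra.br_skew i j (x : 𝔤) (y : 𝔤) hx hy)
  br_jacobi i j x y z hx hy :=
    Subtype.ext (LieSuperalgebra.br_jacobi i j (x : 𝔤) (y : 𝔤) (z : 𝔤) hx hy)

/-! ### The universal enveloping algebra -/

/-- The relations `x y = (-1)^{|x||y|} y x + [x, y]` for homogeneous `x`, `y`. -/
inductive Rel (𝔤 : Type*) [AddCommGroup 𝔤] [Module ℂ 𝔤] [SuperSpace 𝔤] [LieSuperalgebra 𝔤] :
    TensorAlgebra ℂ 𝔤 → TensorAlgebra ℂ 𝔤 → Prop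
  | mk (i j : ZMod 2) (x y : 𝔤) (hx : x ∈ part i) (hy : y ∈ part j) :
      Rel 𝔤 (TensorAlgebra.ι ℂ x * TensorAlgebra.ι ℂ y)
        (koszul i j • (TensorAlgebra.ι ℂ y * TensorAlgebra.ι ℂ x) + TensorAlgebra.ι ℂ (br x y))

/-- The universal enveloping algebra `U(𝔤)`. -/
def Env (𝔤 : Type*) [AddCommGroup 𝔤] [Module ℂ 𝔤] [SuperSpace 𝔤] [LieSuperalgebra 𝔤] : Type _ :=
  RingQuot (Rel 𝔤)

instance : Ring (Env 𝔤) := inferInstanceAs (Ring (RingQuot (Rel 𝔤)))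
instance : Algebra ℂ (Env 𝔤) := inferInstanceAs (Algebra ℂ (RingQuot (Rel 𝔤)))

namespace Env

/-- The canonical map `𝔤 → U(𝔤)`. -/
def ι : 𝔤 →ₗ[ℂ] Env 𝔤 :=
  (RingQuot.mkAlgHom ℂ (Rel 𝔤)).toLinearMap ∘ₗ TensorAlgebra.ι ℂ

theorem ι_mul {i j : ZMod 2} {x y : 𝔤} (hx : x ∈ part i) (hy : y ∈ part j) :
    (ι x * ι y : Env 𝔤) = koszul i j • (ι y * ι x) + ι (br x y) := by
  have h := RingQuot.mkAlgHom_rel ℂ (Rel.mk i j x y hx hy)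
  rw [map_mul, map_add, map_smul, map_mul] at h
  exact h

/-- The universal property of `U(𝔤)`. -/
def lift {A : Type*} [Ring A] [Algebra ℂ A] (f : 𝔤 →ₗ[ℂ] A)
    (hf : ∀ (i j : ZMod 2) (x y : 𝔤), x ∈ part i → y ∈ part j →
      f x * f y = koszul i j • (f y * f x) + f (br x y)) : Env 𝔤 →ₐ[ℂ] A :=
  RingQuot.liftAlgHom ℂ ⟨TensorAlgebra.lift ℂ f, by
    rintro _ _ ⟨i, j, x, y, hx, hy⟩
    simpa using hf i j x y hx hy⟩

@[simp] theorem lift_ι {A : Type*} [Ring A] [Algebra ℂ A] (f : 𝔤 →ₗ[ℂ] A)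
    (hf : ∀ (i j : ZMod 2) (x y : 𝔤), x ∈ part i → y ∈ part j →
      f x * f y = koszul i j • (f y * f x) + f (br x y)) (x : 𝔤) : lift f hf (ι x) = f x := by
  simp only [lift, ι]
  erw [RingQuot.liftAlgHom_mkAlgHom_apply]
  simp

theorem induct {P : Env 𝔤 → Prop} (h1 : ∀ z : ℂ, P (algebraMap ℂ _ z)) (hι : ∀ x : 𝔤, P (ι x))
    (hmul : ∀ a b, P a → P b → P (a * b)) (hadd : ∀ a b, P a → P b → P (a + b)) (u : Env 𝔤) :
    P u := by
  obtain ⟨t, rfl⟩ := RingQuot.mkAlgHom_surjective ℂ (Rel 𝔤) u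
  induction t using TensorAlgebra.induction with
  | algebraMap z => rw [AlgHom.commutes]; exact h1 z
  | ι x => exact hι x
  | mul a b ha hb => rw [map_mul]; exact hmul _ _ ha hb
  | add a b ha hb => rw [map_add]; exact hadd _ _ ha hb

/-- Products `x_1 x_2 ⋯ x_n` of homogeneous elements of `𝔤`, with parity `|x_1| + ⋯ + |x_n|`. -/
inductive IsMonomial : ZMod 2 → Env 𝔤 → Prop
  | one : IsMonomial 0 1
  | ι_mul (i j : ZMod 2) (x : 𝔤) (u : Env 𝔤) (hx : x ∈ part i) (hu : IsMonomial j u) :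
      IsMonomial (i + j) (ι x * u)

/-- The homogeneous component of parity `k` of `U(𝔤)`. -/
def comp (k : ZMod 2) : Submodule ℂ (Env 𝔤) := Submodule.span ℂ {u | IsMonomial k u}

def parityHom : Env 𝔤 →ₐ[ℂ] Env 𝔤 :=
  lift (ι ∘ₗ parity 𝔤) (by
    intro i j x y hx hy
    have h := parity_apply (LieSuperalgebra.br_mem i j x y hx hy)
    simp only [LinearMap.comp_apply, h, parity_apply hx, parity_apply hy, map_smul, sgn_add,
      smul_mul_smul_comm, ι_mul hx hy, smul_add]
    rw [smul_comm, mul_comm (sgn j)])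

theorem parityHom_monomial {k : ZMod 2} {u : Env 𝔤} (hu : IsMonomial k u) :
    parityHom u = sgn k • u := by
  induction hu with
  | one => simp [sgn]
  | ι_mul i j x u hx hu ih =>
    rw [map_mul, ih, sgn_add, parityHom, lift_ι, LinearMap.comp_apply, parity_apply hx, map_smul,
      smul_mul_smul_comm]

theorem parityHom_comp {k : ZMod 2} {u : Env 𝔤} (hu : u ∈ comp k) : parityHom u = sgn k • u := by
  induction hu using Submodule.span_induction with
  | mem u hu => exact parityHom_monomial hu
  | zero => simp
  | add a b _ _ ha hb => simp [ha, hb]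
  | smul z a _ ha => rw [map_smul, ha, smul_comm]

theorem ι_mul_mem {i k : ZMod 2} {x : 𝔤} {u : Env 𝔤} (hx : x ∈ part i) (hu : u ∈ comp k) :
    ι x * u ∈ comp (i + k) := by
  induction hu using Submodule.span_induction with
  | mem u hu => exact Submodule.subset_span (.ι_mul i k x u hx hu)
  | zero => simp
  | add a b _ _ ha hb => rw [mul_add]; exact add_mem ha hb
  | smul z a _ ha => rw [mul_smul_comm]; exact Submodule.smul_mem _ _ ha

theorem one_mem : (1 : Env 𝔤) ∈ comp 0 := Submodule.subset_span .one

theorem ι_mul_mem_sup (x : 𝔤) (u : Env 𝔤) (hu : u ∈ (comp 0 ⊔ comp 1 : Submodule ℂ (Env 𝔤))) :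
    ι x * u ∈ (comp 0 ⊔ comp 1 : Submodule ℂ (Env 𝔤)) := by
  obtain ⟨a, ha, b, hb, rfl⟩ := exists_parts x
  obtain ⟨p, hp, q, hq, rfl⟩ := Submodule.mem_sup.1 hu
  have h1 := ι_mul_mem ha hp
  have h2 := ι_mul_mem ha hq
  have h3 := ι_mul_mem hb hp
  have h4 := ι_mul_mem hb hq
  have e : (1 + 1 : ZMod 2) = 0 := rfl
  rw [zero_add] at h1 h2
  rw [add_zero] at h3
  rw [e] at h4
  rw [map_add, add_mul, mul_add, mul_add]
  exact add_mem (add_mem (Submodule.mem_sup_left h1) (Submodule.mem_sup_right h2))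
    (add_mem (Submodule.mem_sup_right h3) (Submodule.mem_sup_left h4))

theorem mul_mem_sup (w u : Env 𝔤) (hu : u ∈ (comp 0 ⊔ comp 1 : Submodule ℂ (Env 𝔤))) :
    w * u ∈ (comp 0 ⊔ comp 1 : Submodule ℂ (Env 𝔤)) := by
  induction w using induct generalizing u with
  | h1 z => rw [← Algebra.smul_def]; exact Submodule.smul_mem _ _ hu
  | hι x => exact ι_mul_mem_sup x u hu
  | hmul a b ha hb => rw [mul_assoc]; exact ha _ (hb _ hu)
  | hadd a b ha hb => rw [add_mul]; exact add_mem (ha _ hu) (hb _ hu)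

instance : SuperSpace (Env 𝔤) where
  part := comp
  isCompl := by
    constructor
    · exact disjoint_of_involution parityHom.toLinearMap _ _
        (fun v hv => by simpa [sgn] using parityHom_comp hv)
        (fun v hv => by simpa [sgn] using parityHom_comp hv)
    · rw [codisjoint_iff, eq_top_iff]
      intro u _
      simpa using mul_mem_sup u 1 (Submodule.mem_sup_left one_mem)

/-- The algebra map `U(𝔟) → U(𝔤)` induced by the inclusion of a subalgebra. -/
def incl (𝔟 : Subalg 𝔤) : Env 𝔟.space →ₐ[ℂ] Env 𝔤 :=
  lift (ι ∘ₗ 𝔟.space.subtype) (fun _ _ x y hx hy => ι_mul (x := (x : 𝔤)) (y := (y : 𝔤)) hx hy)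

/-- The representation of `U(𝔤)` on a `𝔤`-module. -/
def rep (𝔤 V : Type*) [AddCommGroup 𝔤] [Module ℂ 𝔤] [SuperSpace 𝔤] [LieSuperalgebra 𝔤]
    [AddCommGroup V] [Module ℂ V] [SuperSpace V] [LieSupermodule 𝔤 V] :
    Env 𝔤 →ₐ[ℂ] Module.End ℂ V :=
  lift (A := Module.End ℂ V) act (fun i j x y hx hy => LinearMap.ext fun v =>
    sub_eq_iff_eq_add'.1 (LieSupermodule.act_br i j x y v hx hy))

theorem incl_parityHom (𝔟 : Subalg 𝔤) (b : Env 𝔟.space) :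
    parityHom (incl 𝔟 b) = incl 𝔟 (parityHom b) := by
  induction b using induct with
  | h1 z => simp
  | hι x =>
    obtain ⟨p, hp, q, hq, rfl⟩ := exists_parts x
    have hp' : (p : 𝔤) ∈ part 0 := hp
    have hq' : (q : 𝔤) ∈ part 1 := hq
    have h : ∀ y, incl 𝔟 (ι y) = ι (y : 𝔤) := fun y => lift_ι _ _ y
    have h' : ∀ y : 𝔤, parityHom (ι y) = ι (parity 𝔤 y) := fun y => by simp [parityHom]
    have h'' : ∀ y : 𝔟.space, parityHom (ι y) = ι (parity 𝔟.space y) := fun y => by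
      simp [parityHom]
    simp only [map_add, h, h', h'', parity_apply hp, parity_apply hq, parity_apply hp',
      parity_apply hq', map_smul]
  | hmul a b ha hb => simp [ha, hb]
  | hadd a b ha hb => simp [ha, hb]

theorem rep_parityHom {V : Type*} [AddCommGroup V] [Module ℂ V] [SuperSpace V]
    [LieSupermodule 𝔤 V] (b : Env 𝔤) (v : V) :
    parity V (rep 𝔤 V b v) = rep 𝔤 V (parityHom b) (parity V v) := by
  induction b using induct generalizing v with
  | h1 z => simp [Algebra.algebraMap_eq_smul_one]
  | hι x =>
    have key : ∀ (i j : ZMod 2) (x : 𝔤) (v : V), x ∈ part i → v ∈ part j →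
        parity V (act x v) = act (parity 𝔤 x) (parity V v) := by
      intro i j x v hx hv
      rw [parity_apply hx, parity_apply hv, parity_apply (LieSupermodule.act_mem i j x v hx hv),
        map_smul, map_smul, LinearMap.smul_apply, smul_smul, sgn_add, mul_comm]
    obtain ⟨p, hp, q, hq, rfl⟩ := exists_parts x
    obtain ⟨s, hs, t, ht, rfl⟩ := exists_parts v
    simp only [rep, parityHom, lift_ι, LinearMap.comp_apply, map_add, LinearMap.add_apply,
      key _ _ _ _ hp hs, key _ _ _ _ hp ht, key _ _ _ _ hq hs, key _ _ _ _ hq ht]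
  | hmul a b ha hb => simp [ha, hb]
  | hadd a b ha hb => simp [ha, hb]

end Env

/-! ### Induced modules -/

section ind
variable (𝔟 : Subalg 𝔤) (V : Type*) [AddCommGroup V] [Module ℂ V] [SuperSpace V]
  [LieSupermodule 𝔟.space V]

/-- The `U(𝔤)`-submodule of `U(𝔤) ⊗_ℂ V` generated by all `u b ⊗ v - u ⊗ b v` with `b ∈ U(𝔟)`
(its elements are the `ℂ`-linear combinations of these, as `u ∈ U(𝔤)` is arbitrary). -/
def balanced : Submodule (Env 𝔤) (Env 𝔤 ⊗[ℂ] V) :=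
  Submodule.span (Env 𝔤) {t | ∃ (u : Env 𝔤) (b : Env 𝔟.space) (v : V),
    t = (u * Env.incl 𝔟 b) ⊗ₜ[ℂ] v - u ⊗ₜ[ℂ] (Env.rep 𝔟.space V b v)}

/-- The induced module `U(𝔤) ⊗_{U(𝔟)} V`. -/
abbrev Ind : Type _ := (Env 𝔤 ⊗[ℂ] V) ⧸ balanced 𝔟 V

namespace Ind

/-- The pure tensor `u ⊗ v` in `U(𝔤) ⊗_{U(𝔟)} V`. -/
def tmul (u : Env 𝔤) (v : V) : Ind 𝔟 V := Submodule.Quotient.mk (u ⊗ₜ[ℂ] v)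

/-- The component of parity `k` of the induced module, spanned by the `u ⊗ v` with `u`, `v`
homogeneous and `|u| + |v| = k`. -/
def comp (k : ZMod 2) : Submodule ℂ (Ind 𝔟 V) :=
  Submodule.span ℂ {w | ∃ (i j : ZMod 2) (u : Env 𝔤) (v : V),
    i + j = k ∧ u ∈ part i ∧ v ∈ part j ∧ w = tmul 𝔟 V u v}

def parityTensor : Env 𝔤 ⊗[ℂ] V →ₗ[ℂ] Env 𝔤 ⊗[ℂ] V :=
  TensorProduct.map Env.parityHom.toLinearMap (parity V)

theorem parityTensor_smul (u : Env 𝔤) (t : Env 𝔤 ⊗[ℂ] V) :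
    parityTensor V (u • t) = Env.parityHom u • parityTensor V t := by
  induction t using TensorProduct.induction_on with
  | zero => simp
  | tmul a v => simp [parityTensor, TensorProduct.smul_tmul']
  | add a b ha hb => simp [ha, hb, smul_add]

theorem parityTensor_mem (t : Env 𝔤 ⊗[ℂ] V) (ht : t ∈ balanced 𝔟 V) :
    parityTensor V t ∈ balanced 𝔟 V := by
  refine Submodule.span_induction (p := fun t _ => parityTensor V t ∈ balanced 𝔟 V)
    ?_ ?_ ?_ ?_ ht
  · rintro _ ⟨u, b, v, rfl⟩
    refine Submodule.subset_span ⟨Env.parityHom u, Env.parityHom b, parity V v, ?_⟩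
    simp [parityTensor, Env.incl_parityHom, Env.rep_parityHom]
  · simp
  · intro a b _ _ ha hb
    rw [map_add]
    exact add_mem ha hb
  · intro u a _ ha
    rw [parityTensor_smul]
    exact Submodule.smul_mem _ _ ha

def parityInd : Ind 𝔟 V →ₗ[ℂ] Ind 𝔟 V :=
  (((balanced 𝔟 V).restrictScalars ℂ).liftQ
    (((balanced 𝔟 V).mkQ.restrictScalars ℂ) ∘ₗ parityTensor V) (by
      intro t ht
      exact (Submodule.Quotient.mk_eq_zero _).2 (parityTensor_mem 𝔟 V t ht))) ∘ₗ
  (Submodule.Quotient.restrictScalarsEquiv ℂ (balanced 𝔟 V)).symm.toLinearMap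

theorem parityInd_tmul (u : Env 𝔤) (v : V) :
    parityInd 𝔟 V (tmul 𝔟 V u v) = tmul 𝔟 V (Env.parityHom u) (parity V v) := rfl

theorem tmul_add_left (a b : Env 𝔤) (v : V) :
    tmul 𝔟 V (a + b) v = tmul 𝔟 V a v + tmul 𝔟 V b v := by
  simp [tmul, TensorProduct.add_tmul]

theorem tmul_add_right (a : Env 𝔤) (v w : V) :
    tmul 𝔟 V a (v + w) = tmul 𝔟 V a v + tmul 𝔟 V a w := by
  simp [tmul, TensorProduct.tmul_add]

theorem tmul_smul_smul (y z : ℂ) (a : Env 𝔤) (v : V) :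
    tmul 𝔟 V (y • a) (z • v) = (y * z) • tmul 𝔟 V a v := by
  simp only [tmul, ← Submodule.Quotient.mk_smul, TensorProduct.smul_tmul_smul]

theorem parityInd_comp {k : ZMod 2} {w : Ind 𝔟 V} (hw : w ∈ comp 𝔟 V k) :
    parityInd 𝔟 V w = sgn k • w := by
  induction hw using Submodule.span_induction with
  | mem w hw =>
    obtain ⟨i, j, u, v, rfl, hu, hv, rfl⟩ := hw
    rw [parityInd_tmul, Env.parityHom_comp hu, parity_apply hv, tmul_smul_smul, sgn_add]
  | zero => simp
  | add a b _ _ ha hb => simp [ha, hb]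
  | smul z a _ ha => rw [map_smul, ha, smul_comm]

instance : SuperSpace (Ind 𝔟 V) where
  part := comp 𝔟 V
  isCompl := by
    constructor
    · exact disjoint_of_involution (parityInd 𝔟 V) _ _
        (fun v hv => by simpa [sgn] using parityInd_comp 𝔟 V hv)
        (fun v hv => by simpa [sgn] using parityInd_comp 𝔟 V hv)
    · rw [codisjoint_iff, eq_top_iff]
      intro w hw
      clear hw
      obtain ⟨t, rfl⟩ := Submodule.Quotient.mk_surjective _ w
      induction t using TensorProduct.induction_on with
      | zero => exact Submodule.zero_mem _
      | tmul u v =>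
        change tmul 𝔟 V u v ∈ _
        obtain ⟨p, hp, q, hq, rfl⟩ := exists_parts u
        obtain ⟨s, hs, t, ht, rfl⟩ := exists_parts v
        rw [tmul_add_left, tmul_add_right, tmul_add_right]
        refine add_mem (add_mem ?_ ?_) (add_mem ?_ ?_)
        · exact Submodule.mem_sup_left (Submodule.subset_span ⟨0, 0, p, s, rfl, hp, hs, rfl⟩)
        · exact Submodule.mem_sup_right (Submodule.subset_span ⟨0, 1, p, t, rfl, hp, ht, rfl⟩)
        · exact Submodule.mem_sup_right (Submodule.subset_span ⟨1, 0, q, s, rfl, hq, hs, rfl⟩)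
        · exact Submodule.mem_sup_left (Submodule.subset_span ⟨1, 1, q, t, rfl, hq, ht, rfl⟩)
      | add a b ha hb =>
        rw [Submodule.Quotient.mk_add]
        exact add_mem ha hb

/-- The `𝔤`-module structure of the induced module: `x` acts as left multiplication by
`x ∈ U(𝔤)`. -/
instance : LieSupermodule 𝔤 (Ind 𝔟 V) where
  action := (Algebra.lsmul ℂ ℂ (Ind 𝔟 V)).toLinearMap ∘ₗ Env.ι
  act_mem i j x w hx hw := by
    change Env.ι x • w ∈ comp 𝔟 V (i + j)
    change w ∈ comp 𝔟 V j at hw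
    induction hw using Submodule.span_induction with
    | mem w hw =>
      obtain ⟨k, l, u, v, rfl, hu, hv, rfl⟩ := hw
      exact Submodule.subset_span ⟨i + k, l, Env.ι x * u, v, add_assoc _ _ _,
        Env.ι_mul_mem hx hu, hv, rfl⟩
    | zero => simp
    | add a b _ _ ha hb => rw [smul_add]; exact add_mem ha hb
    | smul z a _ ha => rw [smul_comm]; exact Submodule.smul_mem _ _ ha
  act_br i j x y w hx hy := by
    change Env.ι x • Env.ι y • w - koszul i j • Env.ι y • Env.ι x • w = Env.ι (br x y) • w
    rw [smul_smul, smul_smul, Env.ι_mul hx hy, add_smul, smul_assoc, add_sub_cancel_left]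

end Ind

end ind

end general

/-! ### The `N = 1` Ramond algebra -/

/-- Indices of the basis `L_m`, `G_m` (`m ∈ ℤ`), `C`. -/
inductive RIdx
  | L (m : ℤ)
  | G (m : ℤ)
  | C

/-- The underlying space of the `N = 1` Ramond algebra. -/
abbrev Ramond : Type := RIdx →₀ ℂ

namespace Ramond

def L (m : ℤ) : Ramond := Finsupp.single (.L m) 1
def G (m : ℤ) : Ramond := Finsupp.single (.G m) 1
def C : Ramond := Finsupp.single .C 1

/-- `L_m` and `C` are even, `G_m` is odd. -/
def par : RIdx → ZMod 2
  | .L _ => 0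
  | .G _ => 1
  | .C => 0

instance : SuperSpace Ramond where
  part i := Submodule.span ℂ ((fun b => Finsupp.single b (1 : ℂ)) '' {b | par b = i})
  isCompl := by
    simp only [← Finsupp.supported_eq_span_single]
    constructor
    · refine Finsupp.disjoint_supported_supported ?_
      rw [Set.disjoint_left]
      intro b h0 h1
      simp only [Set.mem_ofPred_eq] at h0 h1
      rw [h0] at h1
      exact absurd h1 (by decide)
    · refine Finsupp.codisjoint_supported_supported ?_
      rw [codisjoint_iff, eq_top_iff]
      rintro (m | m | _) -
      · exact Or.inl rfl
      · exact Or.inr rfl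
      · exact Or.inl rfl

/-- The super brackets of basis vectors. -/
def brBasis : RIdx → RIdx → Ramond
  | .L m, .L n => ((n : ℂ) - m) • L (m + n) +
      (if m + n = 0 then ((m : ℂ) ^ 3 - m) / 12 else 0) • C
  | .G m, .G n => (-2 : ℂ) • L (m + n) +
      (if m + n = 0 then (4 * (m : ℂ) ^ 2 - 1) / 12 else 0) • C
  | .L m, .G n => ((n : ℂ) - m / 2) • G (m + n)
  | .G m, .L n => -(((m : ℂ) - n / 2) • G (m + n))
  | .C, _ => 0
  | _, .C => 0

/-- The super bracket, extended bilinearly from the basis. -/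
def brLin : Ramond →ₗ[ℂ] Ramond →ₗ[ℂ] Ramond :=
  Finsupp.linearCombination ℂ fun a => Finsupp.linearCombination ℂ (brBasis a)

@[simp] theorem brLin_single (a b : RIdx) :
    brLin (Finsupp.single a 1) (Finsupp.single b 1) = brBasis a b := by
  simp [brLin]

theorem single_mem (b : RIdx) : (Finsupp.single b 1 : Ramond) ∈ part (M := Ramond) (par b) :=
  Submodule.subset_span ⟨b, rfl, rfl⟩

theorem brBasis_mem (a b : RIdx) : brBasis a b ∈ part (M := Ramond) (par a + par b) := by
  have hL : ∀ m, L m ∈ part (M := Ramond) 0 := fun m => single_mem (.L m)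
  have hG : ∀ m, G m ∈ part (M := Ramond) 1 := fun m => single_mem (.G m)
  have hC : C ∈ part (M := Ramond) 0 := single_mem .C
  have e : (1 + 1 : ZMod 2) = 0 := rfl
  rcases a with m | m | _ <;> rcases b with n | n | _ <;>
    simp only [brBasis, par, add_zero, zero_add, e]
  · exact add_mem (Submodule.smul_mem _ _ (hL _)) (Submodule.smul_mem _ _ hC)
  · exact Submodule.smul_mem _ _ (hG _)
  · exact Submodule.zero_mem _
  · exact neg_mem (Submodule.smul_mem _ _ (hG _))
  · exact add_mem (Submodule.smul_mem _ _ (hL _)) (Submodule.smul_mem _ _ hC)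
  all_goals exact Submodule.zero_mem _

theorem brBasis_skew (a b : RIdx) :
    brBasis a b = -(koszul (par a) (par b) • brBasis b a) := by
  rcases a with m | m | _ <;> rcases b with n | n | _ <;>
    simp only [brBasis, par, koszul] <;> try simp
  · rw [add_comm n m]
    by_cases h : m + n = 0
    · obtain rfl : n = -m := by omega
      simp only [h, if_true]
      push_cast
      module
    · simp only [h, if_false]
      module
  · rw [add_comm n m]
  · rw [add_comm n m]
  · rw [add_comm n m]
    by_cases h : m + n = 0
    · obtain rfl : n = -m := by omega
      simp only [h, if_true]
      push_cast
      module
    · simp only [h, if_false]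
      module

@[simp] theorem brLin_L_L (m n : ℤ) : brLin (L m) (L n) = ((n : ℂ) - m) • L (m + n) +
    (if m + n = 0 then ((m : ℂ) ^ 3 - m) / 12 else 0) • C := brLin_single (.L m) (.L n)
@[simp] theorem brLin_G_G (m n : ℤ) : brLin (G m) (G n) = (-2 : ℂ) • L (m + n) +
    (if m + n = 0 then (4 * (m : ℂ) ^ 2 - 1) / 12 else 0) • C := brLin_single (.G m) (.G n)
@[simp] theorem brLin_L_G (m n : ℤ) :
    brLin (L m) (G n) = ((n : ℂ) - m / 2) • G (m + n) := brLin_single (.L m) (.G n)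
@[simp] theorem brLin_G_L (m n : ℤ) :
    brLin (G m) (L n) = -(((m : ℂ) - n / 2) • G (m + n)) := brLin_single (.G m) (.L n)
@[simp] theorem brLin_C_left (x : Ramond) : brLin C x = 0 := by
  simp only [brLin, C, Finsupp.linearCombination_single, one_smul]
  rw [Finsupp.linearCombination_apply]
  exact Finset.sum_eq_zero fun b _ => by simp [brBasis]
@[simp] theorem brLin_C_right (x : Ramond) : brLin x C = 0 := by
  induction x using Finsupp.induction_linear with
  | zero => simp
  | add a b ha hb => simp [ha, hb]
  | single a z =>
    rcases a with m | m | _ <;> simp [brLin, C, brBasis]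

theorem brBasis_jacobi (a b d : RIdx) :
    brLin (Finsupp.single a 1) (brLin (Finsupp.single b 1) (Finsupp.single d 1)) =
      brLin (brLin (Finsupp.single a 1) (Finsupp.single b 1)) (Finsupp.single d 1) +
        koszul (par a) (par b) •
          brLin (Finsupp.single b 1) (brLin (Finsupp.single a 1) (Finsupp.single d 1)) := by
  have e1 : ∀ m, Finsupp.single (RIdx.L m) (1 : ℂ) = L m := fun _ => rfl
  have e2 : ∀ m, Finsupp.single (RIdx.G m) (1 : ℂ) = G m := fun _ => rfl
  have e3 : Finsupp.single RIdx.C (1 : ℂ) = C := rfl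
  rcases a with m | m | _ <;> rcases b with n | n | _ <;> rcases d with k | k | _ <;>
    simp only [e1, e2, e3, par, koszul, brLin_L_L, brLin_G_G, brLin_L_G, brLin_G_L, brLin_C_left,
      brLin_C_right, map_add, map_smul, map_neg, LinearMap.add_apply, LinearMap.smul_apply,
      LinearMap.neg_apply, smul_zero, add_zero, neg_zero, map_zero,
      LinearMap.zero_apply, ← add_assoc] <;>
    try simp only [smul_zero, add_zero, neg_zero]
  all_goals
    simp only [add_comm n m]
    by_cases h : m + n + k = 0
    · obtain rfl : k = -m - n := by omega
      try simp only [h, if_true]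
      push_cast
      try simp
      try module
    · try simp only [h, if_false]
      push_cast
      try simp
      try module

instance : LieSuperalgebra Ramond where
  bracket := brLin
  br_mem i j x y hx hy := by
    refine Submodule.span_induction₂ (p := fun x y _ _ => brLin x y ∈ part (i + j))
      ?_ ?_ ?_ ?_ ?_ ?_ ?_ hx hy
    · rintro _ _ ⟨a, rfl, rfl⟩ ⟨b, rfl, rfl⟩
      simpa using brBasis_mem a b
    · intro y _; simp
    · intro x _; simp
    · intro x x' y _ _ _ h h'; simpa using add_mem h h'
    · intro x y y' _ _ _ h h'; simpa using add_mem h h'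
    · intro z x y _ _ h; simpa using Submodule.smul_mem _ z h
    · intro z x y _ _ h; simpa using Submodule.smul_mem _ z h
  br_skew i j x y hx hy := by
    refine Submodule.span_induction₂
      (p := fun x y _ _ => brLin x y = -(koszul i j • brLin y x)) ?_ ?_ ?_ ?_ ?_ ?_ ?_ hx hy
    · rintro _ _ ⟨a, rfl, rfl⟩ ⟨b, rfl, rfl⟩
      simpa using brBasis_skew a b
    · intro y _; simp
    · intro x _; simp
    · intro x x' y _ _ _ h h'
      rw [map_add, LinearMap.add_apply, h, h', map_add]; module
    · intro x y y' _ _ _ h h'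
      rw [map_add, h, h', map_add, LinearMap.add_apply]; module
    · intro z x y _ _ h
      rw [map_smul, LinearMap.smul_apply, h, map_smul]; module
    · intro z x y _ _ h
      rw [map_smul, h, map_smul, LinearMap.smul_apply]; module
  br_jacobi i j x y z hx hy := by
    induction z using Finsupp.induction_linear with
    | zero => simp
    | add p q hp hq => simp only [map_add, hp, hq]; module
    | single d t =>
      refine Submodule.span_induction₂
        (p := fun x y _ _ => brLin x (brLin y (Finsupp.single d t)) =
          brLin (brLin x y) (Finsupp.single d t) +
            koszul i j • brLin y (brLin x (Finsupp.single d t))) ?_ ?_ ?_ ?_ ?_ ?_ ?_ hx hy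
      · rintro _ _ ⟨a, rfl, rfl⟩ ⟨b, rfl, rfl⟩
        have ht : Finsupp.single d t = t • Finsupp.single d (1 : ℂ) := by simp
        rw [ht]
        simp only [map_smul]
        rw [brBasis_jacobi a b d]
        module
      · intro y _; simp
      · intro x _; simp
      · intro x x' y _ _ _ h h'
        simp only [map_add, LinearMap.add_apply, h, h']; module
      · intro x y y' _ _ _ h h'
        simp only [map_add, LinearMap.add_apply, h, h']; module
      · intro z x y _ _ h
        simp only [map_smul, LinearMap.smul_apply, h]; module
      · intro z x y _ _ h
        simp only [map_smul, LinearMap.smul_apply, h]; module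

/-- The indices of `L_m` (`m ≥ 0`), `G_m` (`m ≥ 1`) and `C`. -/
def inB : RIdx → Prop
  | .L m => 0 ≤ m
  | .G m => 1 ≤ m
  | .C => True

/-- The subspace `ℛ_+ ⊕ ℂ L_0 ⊕ ℂ C`, spanned by `L_m` (`m ≥ 0`), `G_m` (`m ≥ 1`) and `C`. -/
def spaceB : Submodule ℂ Ramond :=
  Submodule.span ℂ ((fun b => Finsupp.single b (1 : ℂ)) '' {b | inB b})

theorem L_mem {m : ℤ} (h : 0 ≤ m) : L m ∈ spaceB := Submodule.subset_span ⟨.L m, h, rfl⟩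
theorem G_mem {m : ℤ} (h : 1 ≤ m) : G m ∈ spaceB := Submodule.subset_span ⟨.G m, h, rfl⟩
theorem C_mem : C ∈ spaceB := Submodule.subset_span ⟨.C, trivial, rfl⟩

/-- The subalgebra `ℬ = ℛ_+ ⊕ ℂ L_0 ⊕ ℂ C`. -/
def B : Subalg Ramond where
  space := spaceB
  graded := by
    refine Submodule.span_le.2 ?_
    rintro _ ⟨b, hb, rfl⟩
    have h : (Finsupp.single b 1 : Ramond) ∈ spaceB := Submodule.subset_span ⟨b, hb, rfl⟩
    have h' := single_mem b
    rcases b with m | m | _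
    · exact Submodule.mem_sup_left ⟨h, h'⟩
    · exact Submodule.mem_sup_right ⟨h, h'⟩
    · exact Submodule.mem_sup_left ⟨h, h'⟩
  br_mem x hx y hy := by
    change brLin x y ∈ spaceB
    refine Submodule.span_induction₂ (p := fun x y _ _ => brLin x y ∈ spaceB)
      ?_ ?_ ?_ ?_ ?_ ?_ ?_ hx hy
    · rintro _ _ ⟨a, ha, rfl⟩ ⟨b, hb, rfl⟩
      rw [brLin_single]
      rcases a with m | m | _ <;> rcases b with n | n | _ <;>
        simp only [Set.mem_ofPred_eq, inB] at ha hb <;> simp only [brBasis]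
      · exact add_mem (Submodule.smul_mem _ _ (L_mem (by omega))) (Submodule.smul_mem _ _ C_mem)
      · exact Submodule.smul_mem _ _ (G_mem (by omega))
      · exact Submodule.zero_mem _
      · exact neg_mem (Submodule.smul_mem _ _ (G_mem (by omega)))
      · exact add_mem (Submodule.smul_mem _ _ (L_mem (by omega))) (Submodule.smul_mem _ _ C_mem)
      all_goals exact Submodule.zero_mem _
    · intro y _; simp
    · intro x _; simp
    · intro x x' y _ _ _ h h'; simpa using add_mem h h'
    · intro x y y' _ _ _ h h'; simpa using add_mem h h'
    · intro z x y _ _ h; simpa using Submodule.smul_mem _ z h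
    · intro z x y _ _ h; simpa using Submodule.smul_mem _ z h

/-- The elements `L_m` (`m ≥ 0`), `G_m` (`m ≥ 1`), `C` as elements of `ℬ`. -/
def LB (m : ℤ) (h : 0 ≤ m) : B.space := ⟨L m, L_mem h⟩
def GB (m : ℤ) (h : 1 ≤ m) : B.space := ⟨G m, G_mem h⟩
def CB : B.space := ⟨C, C_mem⟩

end Ramond

end SuperLie

end

noncomputable section

namespace SuperLie

open SuperSpace (part)

/-! Let `𝔫` be the span of the `L_m` and `G_m` with `m < 0`. It is a subalgebra, but it stops being
one when `G_0` is added, since `[G_0, G_0]` involves `L_0` and `C`. So `G_0` is put on the other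
side, and the induced module is compared with `U(𝔫) ⊗ (V ⊕ G_0 V)`.

It is enough that every nonzero invariant subspace, graded or not, meets `1 ⊗ V` (`Ind.isSimple`):
for a graded one, the vectors of `V` it contains form a nonzero graded submodule, hence all of `V`,
and `V` generates.

To get down to `V`, call `L_k` (`k < 0`) and `G_k` (`k ≤ 0`) letters. Letters of index `k < 0` have
weight `-2k`, and `G_0` has weight `1`. The induced module is filtered by weight and then by number
of letters. The operators `L_{r+i}` (`i > 0`) and `G_{r+i}` (`i ≥ 0`) strictly lower the weight; the
doubled weights leave room for `G_r`, which turns `G_0 v` into a multiple of `L_r v`. Hence they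
kill a nonzero vector of minimal weight in the subspace.

Such a vector lies in `V`. On words of length `p`, a suitable combination of the `L_{-i} L_{r+i}`
and `G_{-i} G_{r+i}` (`euler`) acts to leading order as `p T`, where `T` is `L_r` acting on the
factor `V` alone: `[L_{r+i}, L_{-i}]` and `[G_{r+i}, G_{-i}]` are nonzero multiples of `L_r`, and
all other brackets fall lower in the filtration (`eulerTerm`, `euler_word`). The operator kills the
vector and `T` is bijective (`opL_surjective`), so the length drops to zero, then the weight drops,
and so on (`Lowering.mem_of_forall_eq_zero`).

Words are unordered and need only span, so no PBW basis is needed. What is needed is that `T` is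
well defined and that `V` embeds. Both come from an explicit module structure on `U(𝔫) ⊗ (V ⊕ G_0
V)` (`matched`, `dbl`), into which the induced module embeds (`ind_isSimple`). -/

/-! ### Koszul signs, enveloping algebras and representations -/

theorem koszul_comm (i j : ZMod 2) : koszul i j = koszul j i := by
  simp only [koszul, and_comm]

theorem koszul_mul_self (i j : ZMod 2) : koszul i j * koszul i j = 1 := by
  unfold koszul; split_ifs <;> norm_num

theorem koszul_add_left (i j k : ZMod 2) : koszul (i + j) k = koszul i k * koszul j k := by
  have e : (1 + 1 : ZMod 2) = 0 := rfl
  rcases zmod2_cases i with rfl | rfl <;> rcases zmod2_cases j with rfl | rfl <;>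
    rcases zmod2_cases k with rfl | rfl <;> simp [koszul, e]

theorem koszul_add_right (i j k : ZMod 2) : koszul k (i + j) = koszul k i * koszul k j := by
  rw [koszul_comm, koszul_add_left, koszul_comm i, koszul_comm j]

section general
variable {𝔤 : Type*} [AddCommGroup 𝔤] [Module ℂ 𝔤] [SuperSpace 𝔤] [LieSuperalgebra 𝔤]

/-- Induction on the universal enveloping algebra along left multiplication by generators. -/
theorem Env.induct_left {P : Env 𝔤 → Prop} (h1 : P 1)
    (hι : ∀ (i : ZMod 2) (x : 𝔤), x ∈ part i → ∀ u, P u → P (Env.ι x * u))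
    (hadd : ∀ a b, P a → P b → P (a + b)) (hsmul : ∀ (z : ℂ) a, P a → P (z • a)) (u : Env 𝔤) :
    P u := by
  have h0 : P 0 := by simpa using hsmul 0 1 h1
  have hmon : ∀ (k : ZMod 2) (a : Env 𝔤), Env.IsMonomial k a → P a := by
    intro k a ha
    induction ha with
    | one => exact h1
    | ι_mul i j x u hx _ ih => exact hι i x hx u ih
  have hcomp : ∀ (k : ZMod 2) (a : Env 𝔤), a ∈ Env.comp k → P a := by
    intro k a ha
    induction ha using Submodule.span_induction with
    | mem a ha => exact hmon k a ha
    | zero => exact h0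
    | add a b _ _ ha hb => exact hadd _ _ ha hb
    | smul z a _ ha => exact hsmul _ _ ha
  obtain ⟨a, ha, b, hb, rfl⟩ := exists_parts u
  exact hadd _ _ (hcomp 0 a ha) (hcomp 1 b hb)

/-- Induction on `U(𝔤) ⊗ X` along left multiplication by generators. -/
theorem Env.tensor_induct {X : Type*} [AddCommGroup X] [Module ℂ X]
    {P : Env 𝔤 ⊗[ℂ] X → Prop} (h1 : ∀ v, P (1 ⊗ₜ v))
    (hι : ∀ (i : ZMod 2) (x : 𝔤), x ∈ part i → ∀ w, P w → P (Env.ι x • w))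
    (hadd : ∀ a b, P a → P b → P (a + b)) (hsmul : ∀ (z : ℂ) a, P a → P (z • a))
    (w : Env 𝔤 ⊗[ℂ] X) : P w := by
  induction w using TensorProduct.induction_on with
  | zero => simpa using h1 0
  | add a b ha hb => exact hadd _ _ ha hb
  | tmul u v =>
    induction u using Env.induct_left with
    | h1 => exact h1 v
    | hι i x hx u hu => simpa [TensorProduct.smul_tmul'] using hι i x hx _ hu
    | hadd a b ha hb => rw [TensorProduct.add_tmul]; exact hadd _ _ ha hb
    | hsmul z a ha => rw [← TensorProduct.smul_tmul']; exact hsmul _ _ ha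

/-- A linear map `ρ` into an algebra which turns super brackets into super commutators. -/
def IsRep {A : Type*} [Ring A] [Algebra ℂ A] (ρ : 𝔤 →ₗ[ℂ] A) : Prop :=
  ∀ (i j : ZMod 2) (x y : 𝔤), x ∈ part i → y ∈ part j →
    ρ x * ρ y = koszul i j • (ρ y * ρ x) + ρ (br x y)

/-- Jacobi with the last inner bracket turned round by skew-symmetry. In this form it controls `z ↦
[z, y]`, the operation used in `homAct`. -/
theorem br_br_right (i j k : ZMod 2) (x y z : 𝔤) (hx : x ∈ part i) (hy : y ∈ part j)
    (hz : z ∈ part k) :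
    br (br x y) z = br x (br y z) + koszul j k • br (br x z) y := by
  have h := LieSuperalgebra.br_jacobi i j x y z hx hy
  have h1 := LieSuperalgebra.br_skew j (i + k) y (br x z) hy
    (LieSuperalgebra.br_mem _ _ _ _ hx hz)
  change br y (br x z) = _ at h1
  change br x (br y z) = br (br x y) z + koszul i j • br y (br x z) at h
  rw [h, h1, koszul_add_right, koszul_comm j i, smul_neg, smul_smul, ← mul_assoc,
    koszul_mul_self, one_mul]
  abel

/-! ### Modules induced along a complementary subalgebra -/

section matched
variable (𝔫 : Subalg 𝔤) {X : Type*} [AddCommGroup X] [Module ℂ X]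

/-- The action of `𝔫` on `Hom(𝔤, M)`, for an `𝔫`-module `M`. -/
def homAct {M : Type*} [AddCommGroup M] [Module ℂ M] (l : 𝔫.space →ₗ[ℂ] Module.End ℂ M) :
    𝔫.space →ₗ[ℂ] Module.End ℂ (𝔤 →ₗ[ℂ] M) :=
  LinearMap.mk₂ ℂ (fun y f =>
    -- The two halves pick out the even and the odd part of `z`; on the odd part the parity of `y`
    -- supplies the sign. This makes `(y f)(z) = (-1)^{|y||z|} y f(z) + f([z, y])` bilinear without
    -- assuming homogeneity.
    (2⁻¹ : ℂ) • (l y ∘ₗ f ∘ₗ (LinearMap.id + parity 𝔤)) +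
    (2⁻¹ : ℂ) • (l (parity 𝔫.space y) ∘ₗ f ∘ₗ (LinearMap.id - parity 𝔤)) +
    f ∘ₗ br.flip (y : 𝔤))
    (fun y y' f => by ext z; simp; module)
    (fun a y f => by ext z; simp; module)
    (fun y f f' => by ext z; simp; module)
    (fun a y f => by ext z; simp; module)

variable {𝔫} in
theorem homAct_apply {M : Type*} [AddCommGroup M] [Module ℂ M]
    (l : 𝔫.space →ₗ[ℂ] Module.End ℂ M) {i j : ZMod 2} {y : 𝔫.space} {z : 𝔤} (hy : y ∈ part j)
    (hz : z ∈ part i) (f : 𝔤 →ₗ[ℂ] M) :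
    homAct 𝔫 l y f z = koszul i j • l y (f z) + f (br z y) := by
  have h1 := parity_apply hy
  have h2 := parity_apply hz
  simp only [homAct, LinearMap.mk₂_apply, LinearMap.add_apply, LinearMap.smul_apply,
    LinearMap.comp_apply, LinearMap.sub_apply, LinearMap.id_apply, h1, h2,
    LinearMap.flip_apply]
  rcases zmod2_cases i with rfl | rfl <;> rcases zmod2_cases j with rfl | rfl <;>
    simp [koszul, sgn] <;> module

/-- The terms `l y (l y' (f z))` obey the relation for `l`, those in `f([[z, y], y'])` obey Jacobi,
and the mixed terms cancel. As a result the action extends to `U(𝔫)`, so an action of `𝔤` can be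
defined by recursion on products in `U(𝔫)` with no choice of basis. -/
theorem homAct_isRep {M : Type*} [AddCommGroup M] [Module ℂ M]
    {l : 𝔫.space →ₗ[ℂ] Module.End ℂ M} (hl : IsRep l) : IsRep (homAct 𝔫 l) := by
  intro j k y y' hy hy'
  have hext : ∀ f g : 𝔤 →ₗ[ℂ] M, (∀ (i : ZMod 2) (z : 𝔤), z ∈ part i → f z = g z) → f = g := by
    intro f g h
    ext z
    obtain ⟨a, ha, b, hb, rfl⟩ := exists_parts z
    rw [map_add, map_add, h 0 a ha, h 1 b hb]
  refine LinearMap.ext fun f => hext _ _ fun i z hz => ?_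
  have hy1 : (y : 𝔤) ∈ part j := hy
  have hy2 : (y' : 𝔤) ∈ part k := hy'
  have hzy := LieSuperalgebra.br_mem i j z y hz hy1
  have hzy' := LieSuperalgebra.br_mem i k z y' hz hy2
  have hyy := LieSuperalgebra.br_mem j k y y' hy hy'
  have hJ := br_br_right i j k z y y' hz hy1 hy2
  have hc : ((br y y' : 𝔫.space) : 𝔤) = br (y : 𝔤) (y' : 𝔤) := rfl
  have e := LinearMap.congr_fun (hl j k y y' hy hy') (f z)
  simp only [LinearMap.add_apply, LinearMap.smul_apply, Module.End.mul_apply] at e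
  simp only [LinearMap.add_apply, LinearMap.smul_apply, Module.End.mul_apply,
    homAct_apply l hy hz, homAct_apply l hy' hz, homAct_apply l hyy hz, homAct_apply l hy' hzy,
    homAct_apply l hy hzy', hJ, hc, map_add, map_smul, e]
  have e1 : (1 + 1 : ZMod 2) = 0 := rfl
  rcases zmod2_cases i with rfl | rfl <;> rcases zmod2_cases j with rfl | rfl <;>
    rcases zmod2_cases k with rfl | rfl <;> simp [koszul, e1] <;> module

/-- The `U(𝔫)`-module structure of `Hom(𝔤, M)`. -/
def homRep {M : Type*} [AddCommGroup M] [Module ℂ M]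
    {l : 𝔫.space →ₗ[ℂ] Module.End ℂ M} (hl : IsRep l) :
    Env 𝔫.space →ₐ[ℂ] Module.End ℂ (𝔤 →ₗ[ℂ] M) :=
  Env.lift (homAct 𝔫 l) (homAct_isRep 𝔫 hl)

theorem homRep_ι_mul {M : Type*} [AddCommGroup M] [Module ℂ M]
    {l : 𝔫.space →ₗ[ℂ] Module.End ℂ M} (hl : IsRep l) (y : 𝔫.space) (u : Env 𝔫.space)
    (f : 𝔤 →ₗ[ℂ] M) : homRep 𝔫 hl (Env.ι y * u) f = homAct 𝔫 l y (homRep 𝔫 hl u f) := by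
  rw [homRep, map_mul, Module.End.mul_apply]
  exact LinearMap.congr_fun (Env.lift_ι (A := Module.End ℂ (𝔤 →ₗ[ℂ] M)) _ _ y) _

variable (X) in
/-- Left multiplication of `𝔫` on `U(𝔫) ⊗ X`. -/
def leftMul : 𝔫.space →ₗ[ℂ] Module.End ℂ (Env 𝔫.space ⊗[ℂ] X) :=
  (Algebra.lsmul ℂ ℂ (Env 𝔫.space ⊗[ℂ] X)).toLinearMap ∘ₗ Env.ι

variable (X) in
theorem leftMul_isRep : IsRep (A := Module.End ℂ (Env 𝔫.space ⊗[ℂ] X)) (leftMul 𝔫 X) := by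
  intro i j x y hx hy
  simp only [leftMul, LinearMap.comp_apply, AlgHom.toLinearMap_apply, ← map_mul,
    Env.ι_mul hx hy, map_add, map_smul]

variable (π : 𝔤 →ₗ[ℂ] 𝔫.space) (σ : 𝔤 →ₗ[ℂ] Module.End ℂ X)

/-- The action of `𝔤` on the generators `1 ⊗ v` of `U(𝔫) ⊗ X`. -/
def matchedBase : X →ₗ[ℂ] 𝔤 →ₗ[ℂ] Env 𝔫.space ⊗[ℂ] X :=
  LinearMap.mk₂ ℂ (fun v z => Env.ι (π z) ⊗ₜ v + 1 ⊗ₜ σ z v)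
    (fun _ _ _ => by simp [TensorProduct.tmul_add]; abel)
    (fun _ _ _ => by simp)
    (fun _ _ _ => by simp [TensorProduct.tmul_add, TensorProduct.add_tmul]; abel)
    (fun _ _ _ => by simp [TensorProduct.smul_tmul'])

/-- The action of `𝔤 = 𝔫 ⊕ 𝔭` on `U(𝔫) ⊗ X`, for a `𝔭`-module `X`. -/
def matched : 𝔤 →ₗ[ℂ] Module.End ℂ (Env 𝔫.space ⊗[ℂ] X) :=
  -- Acting by `u` on the map `z ↦ z (1 ⊗ v)` gives `z ↦ z (u ⊗ v)`. All `z` must be treated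
  -- together, because passing `z` across `y ∈ 𝔫` creates `[z, y]`, which can be any element of `𝔤`.
  (TensorProduct.lift ((((homRep 𝔫 (leftMul_isRep 𝔫 X)).toLinearMap).flip ∘ₗ matchedBase 𝔫 π σ).flip)).flip

@[simp] theorem matched_one (z : 𝔤) (v : X) :
    matched 𝔫 π σ z (1 ⊗ₜ v) = Env.ι (π z) ⊗ₜ v + 1 ⊗ₜ σ z v := by
  simp [matched, matchedBase]

/-- The rule `z y = ± y z + [z, y]` built into `homAct`; together with `matched_one` it determines
the action. -/
theorem matched_smul {i j : ZMod 2} {z : 𝔤} {y : 𝔫.space} (hz : z ∈ part i) (hy : y ∈ part j)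
    (w : Env 𝔫.space ⊗[ℂ] X) :
    matched 𝔫 π σ z (Env.ι y • w) =
      koszul i j • Env.ι y • matched 𝔫 π σ z w + matched 𝔫 π σ (br z y) w := by
  have h : matched 𝔫 π σ z (Env.ι y • w) =
      homAct 𝔫 (leftMul 𝔫 X) y ((matched 𝔫 π σ).flip w) z := by
    induction w using TensorProduct.induction_on with
    | zero => simp
    | add a b ha hb => simp [smul_add, ha, hb]
    | tmul u v =>
      simp only [matched, TensorProduct.smul_tmul', smul_eq_mul, LinearMap.flip_flip,
        LinearMap.flip_apply, TensorProduct.lift.tmul, LinearMap.comp_apply,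
        AlgHom.toLinearMap_apply, homRep_ι_mul]
  rw [h, homAct_apply _ hy hz]
  rfl

variable {𝔫 π σ}

/-- Both sides obey the same recursion on `U(𝔫)`, and they agree on `1 ⊗ v` because `π` fixes `𝔫`
and `σ` kills it. -/
theorem matched_of_mem (hπ : ∀ y : 𝔫.space, π y = y) (hσ : ∀ y : 𝔫.space, σ y = 0)
    (y : 𝔫.space) (w : Env 𝔫.space ⊗[ℂ] X) :
    matched 𝔫 π σ y w = Env.ι y • w := by
  have key : ∀ (i : ZMod 2) (y : 𝔫.space), y ∈ part i →
      matched 𝔫 π σ y w = Env.ι y • w := by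
    induction w using Env.tensor_induct with
    | h1 v =>
      intro i y _
      simp [hπ, hσ, TensorProduct.smul_tmul']
    | hadd a b ha hb => intro i y hy; rw [map_add, ha i y hy, hb i y hy, smul_add]
    | hsmul z a ha => intro i y hy; rw [map_smul, ha i y hy, smul_comm]
    | hι j x hx w ih =>
      intro i y hy
      have hy' : (y : 𝔤) ∈ part i := hy
      rw [matched_smul 𝔫 π σ hy' hx, ih i y hy, smul_smul (Env.ι y), Env.ι_mul hy hx, add_smul,
        smul_assoc, mul_smul,
        ← ih (i + j) (br y x) (LieSuperalgebra.br_mem i j y x hy hx)]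
      rfl
  obtain ⟨a, ha, b, hb, rfl⟩ := exists_parts y
  rw [map_add, add_smul, ← key 0 a ha, ← key 1 b hb, ← LinearMap.add_apply, ← map_add]
  rfl

/-- Left factors from `𝔫` are moved out by `matched_smul`, with Jacobi absorbing the brackets, which
leaves the vectors `1 ⊗ v`. There `x` and `y` split along `𝔤 = 𝔫 ⊕ ker π`: two elements of `𝔫` give
the relation of `U(𝔫)`, two elements of `ker π` give the hypothesis on `σ`, and the mixed brackets
are the ones the recursion produces. -/
theorem matched_isRep (hπ : ∀ y : 𝔫.space, π y = y) (hσ : ∀ y : 𝔫.space, σ y = 0)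
    (hpar : ∀ (i : ZMod 2) (z : 𝔤), z ∈ part i → π z ∈ part i)
    (hcl : ∀ (i j : ZMod 2) (x y : 𝔤), x ∈ part i → y ∈ part j → π x = 0 → π y = 0 →
      π (br x y) = 0 ∧ σ x * σ y = koszul i j • (σ y * σ x) + σ (br x y)) :
    IsRep (A := Module.End ℂ (Env 𝔫.space ⊗[ℂ] X)) (matched 𝔫 π σ) := by
  have key : ∀ (w : Env 𝔫.space ⊗[ℂ] X) (i j : ZMod 2) (x y : 𝔤), x ∈ part i → y ∈ part j →
      matched 𝔫 π σ x (matched 𝔫 π σ y w) =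
        koszul i j • matched 𝔫 π σ y (matched 𝔫 π σ x w) + matched 𝔫 π σ (br x y) w := by
    intro w
    induction w using Env.tensor_induct with
    | hadd a b ha hb =>
      intro i j x y hx hy
      simp only [map_add, ha i j x y hx hy, hb i j x y hx hy]
      module
    | hsmul z a ha =>
      intro i j x y hx hy
      simp only [map_smul, ha i j x y hx hy]
      module
    | hι k u hu w ih =>
      intro i j x y hx hy
      have hu' : (u : 𝔤) ∈ part k := hu
      have hxy := LieSuperalgebra.br_mem i j x y hx hy
      have hxu := LieSuperalgebra.br_mem i k x u hx hu'
      have hyu := LieSuperalgebra.br_mem j k y u hy hu'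
      have hJ := br_br_right i j k x y u hx hy hu'
      have hl : ∀ w : Env 𝔫.space ⊗[ℂ] X, Env.ι u • w = leftMul 𝔫 X u w := fun _ => rfl
      have ms : ∀ (i : ZMod 2) (z : 𝔤), z ∈ part i → ∀ w : Env 𝔫.space ⊗[ℂ] X,
          matched 𝔫 π σ z (leftMul 𝔫 X u w) =
            koszul i k • leftMul 𝔫 X u (matched 𝔫 π σ z w) + matched 𝔫 π σ (br z u) w :=
        fun _ _ hz w => matched_smul 𝔫 π σ hz hu w
      simp only [hl, ms _ _ hx, ms _ _ hy, ms _ _ hxy, map_add, map_smul, ih i j x y hx hy, ih _ _ _ _ hxu hy, ih _ _ _ _ hx hyu, hJ,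
        LinearMap.add_apply, LinearMap.smul_apply]
      have e1 : (1 + 1 : ZMod 2) = 0 := rfl
      rcases zmod2_cases i with rfl | rfl <;> rcases zmod2_cases j with rfl | rfl <;>
        rcases zmod2_cases k with rfl | rfl <;> simp [koszul, e1] <;> module
    | h1 v =>
      have hs : ∀ (i j : ZMod 2) (x y : 𝔤), x ∈ part i → y ∈ part j →
          matched 𝔫 π σ x (matched 𝔫 π σ y (1 ⊗ₜ v)) = koszul i j • (Env.ι (π y) * Env.ι (π x)) ⊗ₜ[ℂ] v
            + koszul i j • Env.ι (π y) ⊗ₜ[ℂ] σ x v + Env.ι (π x) ⊗ₜ[ℂ] σ y v + 1 ⊗ₜ[ℂ] σ x (σ y v)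
            + matched 𝔫 π σ (br x (π y)) (1 ⊗ₜ v) := by
        intro i j x y hx hy
        have e : (Env.ι (π y) : Env 𝔫.space) ⊗ₜ[ℂ] v = Env.ι (π y) • (1 ⊗ₜ[ℂ] v) := by
          simp [TensorProduct.smul_tmul']
        rw [matched_one, map_add, e, matched_smul 𝔫 π σ hx (hpar j y hy), matched_one, matched_one,
          matched_one]
        simp only [smul_add, TensorProduct.smul_tmul', smul_eq_mul, mul_one]
        abel
      intro i j x y hx hy
      have hx1 : ((π x : 𝔫.space) : 𝔤) ∈ part i := hpar i x hx
      have hy1 : ((π y : 𝔫.space) : 𝔤) ∈ part j := hpar j y hy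
      obtain ⟨h1, h2⟩ := hcl i j (x - π x) (y - π y) (sub_mem hx hx1) (sub_mem hy hy1)
        (by simp [hπ]) (by simp [hπ])
      have hσ' : ∀ z, σ (z - π z) = σ z := fun z => by rw [map_sub, hσ, sub_zero]
      rw [hσ', hσ'] at h2
      have h2 := LinearMap.congr_fun h2 v
      simp only [LinearMap.add_apply, LinearMap.smul_apply, Module.End.mul_apply] at h2
      have hb : br x y = br (x - π x) (y - π y) - br (π x : 𝔤) (π y : 𝔤)
          + br x (π y : 𝔤) - koszul i j • br y (π x : 𝔤) := by
        have := LieSuperalgebra.br_skew i j (π x : 𝔤) y hx1 hy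
        change br (π x : 𝔤) y = -(koszul i j • br y (π x : 𝔤)) at this
        simp only [map_sub, LinearMap.sub_apply, this]
        abel
      have hm := Env.ι_mul (hpar i x hx) (hpar j y hy)
      have h3 : matched 𝔫 π σ (br (x - π x) (y - π y)) (1 ⊗ₜ v) =
          1 ⊗ₜ (σ (br (x - π x) (y - π y)) v) := by
        rw [matched_one, h1]; simp
      have h4 : matched 𝔫 π σ (br (π x : 𝔤) (π y : 𝔤)) (1 ⊗ₜ[ℂ] v) =
          Env.ι (br (π x) (π y)) ⊗ₜ v := by
        have := matched_of_mem hπ hσ (br (π x) (π y)) (1 ⊗ₜ[ℂ] v)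
        rw [TensorProduct.smul_tmul', smul_eq_mul, mul_one] at this
        exact this
      rw [hs i j x y hx hy, hs j i y x hy hx, hb, map_sub, map_add, map_sub, map_smul,
        LinearMap.sub_apply, LinearMap.add_apply, LinearMap.sub_apply, LinearMap.smul_apply, h3, h4,
        h2, hm, koszul_comm j i]
      simp only [TensorProduct.add_tmul, TensorProduct.tmul_add, TensorProduct.tmul_smul,
        ← TensorProduct.smul_tmul', smul_add, smul_smul, koszul_mul_self, one_smul]
      module
  intro i j x y hx hy
  exact LinearMap.ext fun w => key w i j x y hx hy

end matched
end general

section matched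
variable {𝔤 : Type*} [AddCommGroup 𝔤] [Module ℂ 𝔤] [SuperSpace 𝔤] [LieSuperalgebra 𝔤]
  {𝔫 : Subalg 𝔤} {X : Type*} [AddCommGroup X] [Module ℂ X]
  {π : 𝔤 →ₗ[ℂ] 𝔫.space} {σ : 𝔤 →ₗ[ℂ] Module.End ℂ X}

/-- The universal property of `U(𝔫) ⊗ X` as the `𝔤`-module generated by `X`. -/
theorem exists_matched_hom {W : Type*} [AddCommGroup W] [Module ℂ W]
    {ρ : 𝔤 →ₗ[ℂ] Module.End ℂ W} (hρ : IsRep ρ) (φ : X →ₗ[ℂ] W)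
    (hφ : ∀ z v, ρ z (φ v) = ρ (π z) (φ v) + φ (σ z v)) :
    ∃ Φ : Env 𝔫.space ⊗[ℂ] X →ₗ[ℂ] W, (∀ v, Φ (1 ⊗ₜ v) = φ v) ∧
      ∀ z w, Φ (matched 𝔫 π σ z w) = ρ z (Φ w) := by
  let lam : Env 𝔫.space →ₐ[ℂ] Module.End ℂ W :=
    Env.lift (ρ ∘ₗ 𝔫.space.subtype) (fun i j x y hx hy => hρ i j x y hx hy)
  have hlam : ∀ y : 𝔫.space, lam (Env.ι y) = ρ y := fun y => Env.lift_ι _ _ y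
  let Φ : Env 𝔫.space ⊗[ℂ] X →ₗ[ℂ] W := TensorProduct.lift ((lam.toLinearMap.flip ∘ₗ φ).flip)
  have h1 : ∀ u v, Φ (u ⊗ₜ v) = lam u (φ v) := fun u v => rfl
  have h2 : ∀ (y : 𝔫.space) w, Φ (Env.ι y • w) = ρ y (Φ w) := by
    intro y w
    induction w using TensorProduct.induction_on with
    | zero => simp
    | add a b ha hb => simp only [smul_add, map_add, ha, hb]
    | tmul u v =>
      rw [TensorProduct.smul_tmul', smul_eq_mul, h1, h1, map_mul, Module.End.mul_apply, hlam]
  refine ⟨Φ, fun v => by rw [h1, map_one, Module.End.one_apply], ?_⟩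
  have key : ∀ w (i : ZMod 2) (z : 𝔤), z ∈ part i → Φ (matched 𝔫 π σ z w) = ρ z (Φ w) := by
    intro w
    induction w using Env.tensor_induct with
    | h1 v =>
      intro i z hz
      rw [matched_one, map_add, h1, h1, h1, hlam, map_one, Module.End.one_apply,
        Module.End.one_apply]
      exact (hφ z v).symm
    | hadd a b ha hb => intro i z hz; simp only [map_add, ha i z hz, hb i z hz]
    | hsmul t a ha => intro i z hz; simp only [map_smul, ha i z hz]
    | hι j x hx w ih =>
      intro i z hz
      have hx' : (x : 𝔤) ∈ part j := hx
      rw [matched_smul 𝔫 π σ hz hx, map_add, map_smul, h2, h2, ih i z hz,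
        ih _ _ (LieSuperalgebra.br_mem i j z x hz hx')]
      have := LinearMap.congr_fun (hρ i j z x hz hx') (Φ w)
      simpa using this.symm
  intro z w
  obtain ⟨a, ha, b, hb, rfl⟩ := exists_parts z
  simp only [map_add, LinearMap.add_apply, key w 0 a ha, key w 1 b hb]

/-- An endomorphism `τ` of `X` commuting with `z` extends to `1 ⊗ τ`, which commutes with `z` as
soon as `z` normalizes `𝔫`. -/
theorem matched_lTensor_comm (hπ : ∀ y : 𝔫.space, π y = y) (hσ : ∀ y : 𝔫.space, σ y = 0)
    {i : ZMod 2} {z : 𝔤} (hz : z ∈ part i) (hzn : ∀ y ∈ 𝔫.space, br z y ∈ 𝔫.space)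
    (τ : Module.End ℂ X) (hτ : ∀ v, σ z (τ v) = τ (σ z v)) (w : Env 𝔫.space ⊗[ℂ] X) :
    matched 𝔫 π σ z (τ.lTensor _ w) = τ.lTensor _ (matched 𝔫 π σ z w) := by
  have hl : ∀ (u : Env 𝔫.space) (w : Env 𝔫.space ⊗[ℂ] X),
      τ.lTensor _ (u • w) = u • τ.lTensor _ w := by
    intro u w
    induction w using TensorProduct.induction_on with
    | zero => simp
    | add a b ha hb => simp only [smul_add, map_add, ha, hb]
    | tmul a v => simp [TensorProduct.smul_tmul']
  induction w using Env.tensor_induct with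
  | h1 v => simp [hτ]
  | hadd a b ha hb => simp only [map_add, ha, hb]
  | hsmul t a ha => simp only [map_smul, ha]
  | hι j x hx w ih =>
    -- As `z` normalizes `𝔫`, the bracket `[z, x]` acts by left multiplication and so commutes with
    -- `1 ⊗ τ`.
    have h : ∀ w, matched 𝔫 π σ (br z x) w = Env.ι (⟨br z x, hzn x x.2⟩ : 𝔫.space) • w :=
      fun w => matched_of_mem hπ hσ ⟨br z x, hzn x x.2⟩ w
    rw [hl, matched_smul 𝔫 π σ hz hx, matched_smul 𝔫 π σ hz hx, ih, h, h, map_add, map_smul, hl, hl]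

end matched

/-- The component of parity `i` of a subalgebra. -/
abbrev Subalg.comp {𝔤 : Type*} [AddCommGroup 𝔤] [Module ℂ 𝔤] [SuperSpace 𝔤] [LieSuperalgebra 𝔤]
    (𝔟 : Subalg 𝔤) (i : ZMod 2) : Submodule ℂ 𝔟.space := part i

/-! ### The splitting of the Ramond algebra into negative and nonnegative parts -/

namespace Ramond

/-- The indices of `L_m` and `G_m` with `m < 0`. -/
def isNeg : RIdx → Prop
  | .L m => m < 0
  | .G m => m < 0
  | .C => False

instance : DecidablePred isNeg := Classical.decPred _

/-- The basis vector of a given index. -/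
abbrev e (b : RIdx) : Ramond := Finsupp.single b 1

/-- Pure bilinearity. The predicate `P` is there because the relation will hold only on the
nonnegative part: `dbl` is zero on negative indices and does not represent the whole algebra. -/
theorem rel_of_basis {A : Type*} [Ring A] [Algebra ℂ A] (P : RIdx → Prop)
    (ρ : Ramond →ₗ[ℂ] A)
    (h : ∀ a b, P a → P b → ρ (e a) * ρ (e b) =
      koszul (par a) (par b) • (ρ (e b) * ρ (e a)) + ρ (brLin (e a) (e b)))
    {i j : ZMod 2} {x y : Ramond} (hx : x ∈ Submodule.span ℂ (e '' {b | par b = i ∧ P b}))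
    (hy : y ∈ Submodule.span ℂ (e '' {b | par b = j ∧ P b})) :
    ρ x * ρ y = koszul i j • (ρ y * ρ x) + ρ (br x y) := by
  change ρ x * ρ y = koszul i j • (ρ y * ρ x) + ρ (brLin x y)
  refine Submodule.span_induction₂ (p := fun x y _ _ =>
    ρ x * ρ y = koszul i j • (ρ y * ρ x) + ρ (brLin x y)) ?_ ?_ ?_ ?_ ?_ ?_ ?_ hx hy
  · rintro _ _ ⟨a, ⟨rfl, ha⟩, rfl⟩ ⟨b, ⟨rfl, hb⟩, rfl⟩
    exact h a b ha hb
  · intro y _; simp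
  · intro x _; simp
  · intro x x' y _ _ _ h h'
    simp only [map_add, LinearMap.add_apply, add_mul, mul_add, h, h']; module
  · intro x y y' _ _ _ h h'
    simp only [map_add, add_mul, mul_add, h, h']; module
  · intro z x y _ _ h
    simp only [map_smul, LinearMap.smul_apply, smul_mul_assoc, mul_smul_comm, h]; module
  · intro z x y _ _ h
    simp only [map_smul, smul_mul_assoc, mul_smul_comm, h]; module

/-- The subalgebra spanned by `L_m` and `G_m` with `m < 0`. -/
def N : Subalg Ramond where
  space := Submodule.span ℂ (e '' {b | isNeg b})
  graded := by
    refine Submodule.span_le.2 ?_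
    rintro _ ⟨b, hb, rfl⟩
    have h : e b ∈ Submodule.span ℂ (e '' {b | isNeg b}) := Submodule.subset_span ⟨b, hb, rfl⟩
    have h' := single_mem b
    rcases b with m | m | _
    · exact Submodule.mem_sup_left ⟨h, h'⟩
    · exact Submodule.mem_sup_right ⟨h, h'⟩
    · exact Submodule.mem_sup_left ⟨h, h'⟩
  br_mem x hx y hy := by
    change brLin x y ∈ _
    have hs : ∀ b, isNeg b → e b ∈ Submodule.span ℂ (e '' {b | isNeg b}) :=
      fun b hb => Submodule.subset_span ⟨b, hb, rfl⟩
    have hL : ∀ m : ℤ, m < 0 → L m ∈ Submodule.span ℂ (e '' {b | isNeg b}) :=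
      fun m hm => hs (.L m) hm
    have hG : ∀ m : ℤ, m < 0 → G m ∈ Submodule.span ℂ (e '' {b | isNeg b}) :=
      fun m hm => hs (.G m) hm
    refine Submodule.span_induction₂
      (p := fun x y _ _ => brLin x y ∈ Submodule.span ℂ (e '' {b | isNeg b}))
      ?_ ?_ ?_ ?_ ?_ ?_ ?_ hx hy
    · rintro _ _ ⟨a, ha, rfl⟩ ⟨b, hb, rfl⟩
      rw [brLin_single]
      rcases a with m | m | _ <;> rcases b with n | n | _ <;>
        simp only [Set.mem_ofPred_eq, isNeg] at ha hb <;> simp only [brBasis]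
      · rw [if_neg (by omega), zero_smul, add_zero]
        exact Submodule.smul_mem _ _ (hL _ (by omega))
      · exact Submodule.smul_mem _ _ (hG _ (by omega))
      · exact neg_mem (Submodule.smul_mem _ _ (hG _ (by omega)))
      · rw [if_neg (by omega), zero_smul, add_zero]
        exact Submodule.smul_mem _ _ (hL _ (by omega))
    · intro y _; simp
    · intro x _; simp
    · intro x x' y _ _ _ h h'; simpa using add_mem h h'
    · intro x y y' _ _ _ h h'; simpa using add_mem h h'
    · intro z x y _ _ h; simpa using Submodule.smul_mem _ z h
    · intro z x y _ _ h; simpa using Submodule.smul_mem _ z h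

theorem e_mem_N {b : RIdx} (hb : isNeg b) : e b ∈ N.space := Submodule.subset_span ⟨b, hb, rfl⟩

/-- The projection onto the span of the `L_m` and `G_m` with `m < 0`. -/
def projN : Ramond →ₗ[ℂ] N.space :=
  Finsupp.linearCombination ℂ fun b => if h : isNeg b then ⟨e b, e_mem_N h⟩ else 0

theorem projN_of_isNeg {b : RIdx} (h : isNeg b) : projN (e b) = ⟨e b, e_mem_N h⟩ := by
  simp [projN, h]

theorem projN_of_not_isNeg {b : RIdx} (h : ¬ isNeg b) : projN (e b) = 0 := by
  simp [projN, h]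

theorem projN_coe (y : N.space) : projN y = y := by
  obtain ⟨y, hy⟩ := y
  have h : ((projN y : N.space) : Ramond) = y := by
    refine Submodule.span_induction (p := fun y _ => ((projN y : N.space) : Ramond) = y)
      ?_ ?_ ?_ ?_ hy
    · rintro _ ⟨b, hb, rfl⟩
      rw [projN_of_isNeg hb]
    · simp
    · intro x y _ _ hx hy; simp [hx, hy]
    · intro z x _ hx; simp [hx]
  exact Subtype.ext h

theorem projN_mem_part (i : ZMod 2) (z : Ramond) (hz : z ∈ part i) :
    projN z ∈ N.comp i := by
  change ((projN z : N.space) : Ramond) ∈ part (M := Ramond) i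
  refine Submodule.span_induction
    (p := fun z _ => ((projN z : N.space) : Ramond) ∈ part (M := Ramond) i) ?_ ?_ ?_ ?_ hz
  · rintro _ ⟨b, rfl, rfl⟩
    by_cases h : isNeg b
    · have := projN_of_isNeg h
      simp only [e] at this
      rw [this]; exact single_mem b
    · have := projN_of_not_isNeg h
      simp only [e] at this
      rw [this]; simp
  · simp
  · intro x y _ _ hx hy; simpa using add_mem hx hy
  · intro z x _ hx; simpa using Submodule.smul_mem _ z hx

theorem mem_span_of_projN_eq_zero {i : ZMod 2} {x : Ramond} (hx : x ∈ part i)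
    (h : projN x = 0) : x ∈ Submodule.span ℂ (e '' {b | par b = i ∧ ¬ isNeg b}) := by
  have key : x - projN x ∈ Submodule.span ℂ (e '' {b | par b = i ∧ ¬ isNeg b}) := by
    refine Submodule.span_induction (p := fun x _ =>
      x - projN x ∈ Submodule.span ℂ (e '' {b | par b = i ∧ ¬ isNeg b})) ?_ ?_ ?_ ?_ hx
    · rintro _ ⟨b, rfl, rfl⟩
      by_cases h : isNeg b
      · have := projN_of_isNeg h
        simp only [e] at this
        simp [this]
      · have := projN_of_not_isNeg h
        simp only [e] at this
        simp only [this, Submodule.coe_zero, sub_zero]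
        exact Submodule.subset_span ⟨b, ⟨rfl, h⟩, rfl⟩
    · simp
    · intro x y _ _ hx hy
      rw [map_add, Submodule.coe_add, add_sub_add_comm]; exact add_mem hx hy
    · intro z x _ hx
      rw [map_smul, Submodule.coe_smul, ← smul_sub]; exact Submodule.smul_mem _ z hx
  simpa [h] using key

theorem projN_brLin {a b : RIdx} (ha : ¬ isNeg a) (hb : ¬ isNeg b) :
    projN (brLin (e a) (e b)) = 0 := by
  have hL : ∀ m : ℤ, 0 ≤ m → projN (L m) = 0 :=
    fun m hm => projN_of_not_isNeg (b := .L m) (by simpa [isNeg] using hm)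
  have hG : ∀ m : ℤ, 0 ≤ m → projN (G m) = 0 :=
    fun m hm => projN_of_not_isNeg (b := .G m) (by simpa [isNeg] using hm)
  have hC : projN C = 0 := projN_of_not_isNeg (b := .C) (by simp [isNeg])
  rw [brLin_single]
  rcases a with m | m | _ <;> rcases b with n | n | _ <;>
    simp only [isNeg, not_lt] at ha hb <;> simp only [brBasis, map_add, map_smul, map_neg, hC,
      smul_zero, add_zero, map_zero] <;>
    first | rfl | (rw [hL _ (by omega)]; simp) | (rw [hG _ (by omega)]; simp)

/-- The linear map `x ↦ ρ x` with prescribed values on the basis vectors of nonnegative index, and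
zero on the others, satisfies the hypotheses on the module `X` of `matched`. -/
theorem matched_hyp {X : Type*} [AddCommGroup X] [Module ℂ X] (σ : Ramond →ₗ[ℂ] Module.End ℂ X)
    (h : ∀ a b, ¬ isNeg a → ¬ isNeg b → σ (e a) * σ (e b) =
      koszul (par a) (par b) • (σ (e b) * σ (e a)) + σ (brLin (e a) (e b)))
    (i j : ZMod 2) (x y : Ramond) (hx : x ∈ part i) (hy : y ∈ part j) (hx0 : projN x = 0)
    (hy0 : projN y = 0) :
    projN (br x y) = 0 ∧ σ x * σ y = koszul i j • (σ y * σ x) + σ (br x y) := by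
  have hx' := mem_span_of_projN_eq_zero hx hx0
  have hy' := mem_span_of_projN_eq_zero hy hy0
  refine ⟨?_, rel_of_basis (fun b => ¬ isNeg b) σ h hx' hy'⟩
  change projN (brLin x y) = 0
  refine Submodule.span_induction₂ (p := fun x y _ _ => projN (brLin x y) = 0)
    ?_ ?_ ?_ ?_ ?_ ?_ ?_ hx' hy'
  · rintro _ _ ⟨a, ⟨-, ha⟩, rfl⟩ ⟨b, ⟨-, hb⟩, rfl⟩
    exact projN_brLin ha hb
  · intro y _; simp
  · intro x _; simp
  · intro x x' y _ _ _ h h'; simp [h, h']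
  · intro x y y' _ _ _ h h'; simp [h, h']
  · intro z x y _ _ h; simp [h]
  · intro z x y _ _ h; simp [h]

/-! ### The module `V ⊕ G_0 V` over `ℬ + ℂ G_0` -/

section double
variable (V : Type*) [AddCommGroup V] [Module ℂ V] [SuperSpace V] [LieSupermodule B.space V]

/-- The action of `L_m` on a `ℬ`-module for `m ≥ 0`, extended by zero. -/
def opL (m : ℤ) : Module.End ℂ V := if h : 0 ≤ m then act (LB m h) else 0

/-- The action of `G_m` on a `ℬ`-module for `m ≥ 1`, extended by zero. -/
def opG (m : ℤ) : Module.End ℂ V := if h : 1 ≤ m then act (GB m h) else 0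

variable {V}

theorem LB_mem (m : ℤ) (h : 0 ≤ m) : LB m h ∈ B.comp 0 := single_mem (.L m)
theorem GB_mem (m : ℤ) (h : 1 ≤ m) : GB m h ∈ B.comp 1 := single_mem (.G m)

theorem opL_of_nonneg {m : ℤ} (h : 0 ≤ m) (v : V) : opL V m v = act (LB m h) v := by
  simp [opL, h]

theorem opG_of_pos {m : ℤ} (h : 1 ≤ m) (v : V) : opG V m v = act (GB m h) v := by
  simp [opG, h]

@[simp] theorem opL_of_neg {m : ℤ} (h : m < 0) : opL V m = 0 := by
  simp [opL, not_le.2 h]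

@[simp] theorem opG_of_nonpos {m : ℤ} (h : m ≤ 0) : opG V m = 0 := by
  have : ¬ 1 ≤ m := by omega
  simp [opG, this]

theorem opL_opL {m n : ℤ} (hm : 0 ≤ m) (hn : 0 ≤ n) (v : V) :
    opL V m (opL V n v) = opL V n (opL V m v) + ((n : ℂ) - m) • opL V (m + n) v := by
  have h := LieSupermodule.act_br 0 0 (LB m hm) (LB n hn) v (LB_mem m hm) (LB_mem n hn)
  have hb : br (LB m hm) (LB n hn) = ((n : ℂ) - m) • LB (m + n) (add_nonneg hm hn) := by
    refine Subtype.ext ((brLin_L_L m n).trans ?_)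
    by_cases h : m + n = 0
    · obtain rfl : m = 0 := by omega
      simp [LB]
    · simp [h, LB]
  rw [hb, map_smul] at h
  simp only [opL_of_nonneg hm, opL_of_nonneg hn, opL_of_nonneg (add_nonneg hm hn)]
  rw [sub_eq_iff_eq_add] at h
  change act _ _ = _ at h
  rw [h]
  simp [koszul, add_comm]

theorem opL_opG {m n : ℤ} (hm : 0 ≤ m) (hn : 1 ≤ n) (v : V) :
    opL V m (opG V n v) = opG V n (opL V m v) + ((n : ℂ) - m / 2) • opG V (m + n) v := by
  have hmn : 1 ≤ m + n := by omega
  have h := LieSupermodule.act_br 0 1 (LB m hm) (GB n hn) v (LB_mem m hm) (GB_mem n hn)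
  have hb : br (LB m hm) (GB n hn) = ((n : ℂ) - m / 2) • GB (m + n) hmn :=
    Subtype.ext (brLin_L_G m n)
  rw [hb, map_smul] at h
  simp only [opL_of_nonneg hm, opG_of_pos hn, opG_of_pos hmn]
  rw [sub_eq_iff_eq_add] at h
  change act _ _ = _ at h
  rw [h]
  simp [koszul, add_comm]

theorem opG_opG {m n : ℤ} (hm : 1 ≤ m) (hn : 1 ≤ n) (v : V) :
    opG V m (opG V n v) = -opG V n (opG V m v) + (-2 : ℂ) • opL V (m + n) v := by
  have hmn : 0 ≤ m + n := by omega
  have h := LieSupermodule.act_br 1 1 (GB m hm) (GB n hn) v (GB_mem m hm) (GB_mem n hn)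
  have hb : br (GB m hm) (GB n hn) = (-2 : ℂ) • LB (m + n) hmn := by
    refine Subtype.ext ((brLin_G_G m n).trans ?_)
    have : m + n ≠ 0 := by omega
    simp [this, LB]
  rw [hb, map_smul] at h
  simp only [opG_of_pos hm, opG_of_pos hn, opL_of_nonneg hmn]
  rw [sub_eq_iff_eq_add] at h
  change act _ _ = _ at h
  rw [h]
  simp [koszul, add_comm]

/-- The endomorphism of `V × V` given by a `2 × 2` matrix of endomorphisms of `V`. -/
def block (a b c d : Module.End ℂ V) : Module.End ℂ (V × V) :=
  (LinearMap.coprod a b).prod (LinearMap.coprod c d)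

@[simp] theorem block_apply (a b c d : Module.End ℂ V) (v : V × V) :
    block a b c d v = (a v.1 + b v.2, c v.1 + d v.2) := rfl

variable (V) in
/-- The action of the basis vectors of nonnegative index on `V ⊕ G_0 V`. -/
def dblBasis (c : ℂ) : RIdx → Module.End ℂ (V × V)
  -- The pair `(v, v')` stands for `v + G_0 v'`. The entries come from `L_m G_0 = G_0 L_m - (m/2)
  -- G_m`, `G_m G_0 = -G_0 G_m - 2 L_m` for `m > 0`, and `G_0² = [G_0, G_0]/2 = -L_0 - C/24`.
  | .L m => block (opL V m) (-((m / 2 : ℂ) • opG V m)) 0 (opL V m)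
  | .G m => if m = 0 then block 0 (-opL V 0 - (c / 24) • 1) 1 0
      else block (opG V m) ((-2 : ℂ) • opL V m) 0 (-opG V m)
  | .C => c • 1

variable (V) in
/-- The action of `ℬ + ℂ G_0` on `V ⊕ G_0 V`. -/
def dbl (c : ℂ) : Ramond →ₗ[ℂ] Module.End ℂ (V × V) := Finsupp.linearCombination ℂ (dblBasis V c)

variable (c : ℂ)

theorem dbl_e (b : RIdx) : dbl V c (e b) = dblBasis V c b := by simp [dbl]

theorem dbl_L (m : ℤ) (v : V × V) : dbl V c (L m) v =
    (opL V m v.1 - (m / 2 : ℂ) • opG V m v.2, opL V m v.2) := by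
  rw [show L m = e (.L m) from rfl, dbl_e]
  simp [dblBasis, sub_eq_add_neg]

theorem dbl_G {m : ℤ} (hm : m ≠ 0) (v : V × V) : dbl V c (G m) v =
    (opG V m v.1 - (2 : ℂ) • opL V m v.2, -opG V m v.2) := by
  rw [show G m = e (.G m) from rfl, dbl_e]
  simp [dblBasis, hm, sub_eq_add_neg]

theorem dbl_G_zero (v : V × V) : dbl V c (G 0) v =
    (-opL V 0 v.2 - (c / 24) • v.2, v.1) := by
  rw [show G 0 = e (.G 0) from rfl, dbl_e]
  simp [dblBasis]

theorem dbl_C (v : V × V) : dbl V c C v = c • v := by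
  rw [show C = e .C from rfl, dbl_e]
  simp [dblBasis]

theorem dbl_neg {b : RIdx} (hb : isNeg b) : dbl V c (e b) = 0 := by
  rw [dbl_e]
  rcases b with m | m | _ <;> simp only [isNeg] at hb
  · ext v <;> simp [dblBasis, opL_of_neg hb, opG_of_nonpos hb.le]
  · ext v <;> simp [dblBasis, opL_of_neg hb, opG_of_nonpos hb.le, hb.ne]

/-- The relation without the factor needs `n ≥ 1`. The factor `n`, which is the one in the
off-diagonal entry of `L_n`, makes the case `n = 0` trivial. -/
theorem smul_opL_opG {m n : ℤ} (hm : 0 ≤ m) (hn : 0 ≤ n) (v : V) :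
    (n : ℂ) • opL V m (opG V n v) =
      (n : ℂ) • (opG V n (opL V m v) + ((n : ℂ) - m / 2) • opG V (m + n) v) := by
  obtain rfl | hn := hn.eq_or_lt
  · simp
  · rw [opL_opG hm hn]

theorem dbl_L_L (m n : ℤ) (hm : 0 ≤ m) (hn : 0 ≤ n) (v : V × V) :
    dbl V c (L m) (dbl V c (L n) v) =
      dbl V c (L n) (dbl V c (L m) v) + dbl V c (brLin (L m) (L n)) v := by
  have hc : (if m + n = 0 then ((m : ℂ) ^ 3 - m) / 12 else 0) = 0 := by
    split_ifs with h
    · obtain rfl : m = 0 := by omega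
      simp
    · rfl
  simp only [brLin_L_L, map_add, map_smul, LinearMap.add_apply, LinearMap.smul_apply, dbl_L, hc,
    zero_smul, LinearMap.zero_apply, add_zero]
  have h1 := smul_opL_opG hm hn v.2
  have h2 := smul_opL_opG hn hm v.2
  rw [add_comm n m] at h2
  refine Prod.ext ?_ ?_
  · simp only [map_sub, map_smul, Prod.fst_add, Prod.smul_fst]
    push_cast
    linear_combination (norm := module) opL_opL hm hn v.1 + (-1 / 2 : ℂ) • h1 + (1 / 2 : ℂ) • h2
  · exact opL_opL hm hn v.2

theorem dbl_L_G (m n : ℤ) (hm : 0 ≤ m) (hn : 0 ≤ n) (v : V × V) :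
    dbl V c (L m) (dbl V c (G n) v) =
      dbl V c (G n) (dbl V c (L m) v) + dbl V c (brLin (L m) (G n)) v := by
  obtain rfl | hn := hn.eq_or_lt
  · obtain rfl | hm' := hm.eq_or_lt
    · simp [dbl_G_zero, dbl_L]
    · have h := opL_opL hm le_rfl v.2
      simp only [brLin_L_G, map_smul, LinearMap.smul_apply, dbl_L, dbl_G_zero, add_zero,
        dbl_G c hm'.ne'] at h ⊢
      refine Prod.ext ?_ ?_
      · simp only [map_sub, map_smul, map_neg, Prod.fst_add, Prod.smul_fst]
        push_cast at h ⊢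
        linear_combination (norm := module) -h
      · simp only [Prod.snd_add, Prod.smul_snd]
        push_cast
        module
  · have h1 := opL_opG hm hn v.1
    have h2 := opL_opL hm hn.le v.2
    have h3 := opL_opG hm hn v.2
    have h4 : (m : ℂ) • opG V m (opG V n v.2) =
        (m : ℂ) • (-opG V n (opG V m v.2) + (-2 : ℂ) • opL V (m + n) v.2) := by
      obtain rfl | hm := hm.eq_or_lt
      · simp
      · rw [opG_opG hm hn]
    have hmn : m + n ≠ 0 := by omega
    simp only [brLin_L_G, map_smul, LinearMap.smul_apply, dbl_L, dbl_G c hn.ne', dbl_G c hmn]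
    refine Prod.ext ?_ ?_
    · simp only [map_sub, map_smul, map_neg, Prod.fst_add, Prod.smul_fst]
      linear_combination (norm := module) h1 + (-2 : ℂ) • h2 + (1 / 2 : ℂ) • h4
    · simp only [map_neg, Prod.snd_add, Prod.smul_snd]
      linear_combination (norm := module) -h3

theorem dbl_G_G (m n : ℤ) (hm : 0 ≤ m) (hn : 0 ≤ n) (v : V × V) :
    dbl V c (G m) (dbl V c (G n) v) =
      -dbl V c (G n) (dbl V c (G m) v) + dbl V c (brLin (G m) (G n)) v := by
  have key : ∀ n : ℤ, 0 < n → dbl V c (G 0) (dbl V c (G n) v) =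
      -dbl V c (G n) (dbl V c (G 0) v) + (-2 : ℂ) • dbl V c (L n) v := by
    intro n hn
    have h := opL_opG le_rfl hn v.2
    simp only [dbl_L, dbl_G_zero, dbl_G c hn.ne', zero_add] at h ⊢
    refine Prod.ext ?_ ?_
    · simp only [map_sub, map_smul, map_neg, Prod.fst_add, Prod.smul_fst, Prod.fst_neg]
      push_cast at h ⊢
      linear_combination (norm := module) h
    · simp only [Prod.snd_add, Prod.smul_snd, Prod.snd_neg]
      module
  obtain rfl | hm := hm.eq_or_lt
  · obtain rfl | hn := hn.eq_or_lt
    · simp only [brLin_G_G, map_add, map_smul, LinearMap.add_apply, LinearMap.smul_apply, dbl_L,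
        dbl_G_zero, dbl_C, add_zero, if_true]
      refine Prod.ext ?_ ?_
      · simp only [Prod.fst_add, Prod.smul_fst, Prod.fst_neg]
        push_cast
        module
      · simp only [Prod.snd_add, Prod.smul_snd, Prod.snd_neg]
        push_cast
        module
    · simp only [brLin_G_G, map_add, map_smul, LinearMap.add_apply, LinearMap.smul_apply, zero_add,
        hn.ne', if_false, zero_smul, add_zero]
      exact key n hn
  · obtain rfl | hn := hn.eq_or_lt
    · simp only [brLin_G_G, map_add, map_smul, LinearMap.add_apply, LinearMap.smul_apply,
        hm.ne', if_false, zero_smul, add_zero]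
      rw [key m hm]
      abel
    · have h1 := opG_opG hm hn v.1
      have h2 := opL_opG hm.le hn v.2
      have h3 := opL_opG hn.le hm v.2
      have h4 := opG_opG hm hn v.2
      have hmn : m + n ≠ 0 := by omega
      rw [add_comm n m] at h3
      simp only [brLin_G_G, map_add, map_smul, LinearMap.add_apply, LinearMap.smul_apply, dbl_L,
        dbl_G c hn.ne', dbl_G c hm.ne', hmn, if_false, zero_smul, add_zero]
      refine Prod.ext ?_ ?_
      · simp only [map_sub, map_smul, map_neg, Prod.fst_add, Prod.smul_fst, Prod.fst_neg]
        push_cast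
        linear_combination (norm := module) h1 + (2 : ℂ) • h2 + (2 : ℂ) • h3
      · simp only [map_neg, Prod.snd_add, Prod.smul_snd, Prod.snd_neg]
        linear_combination (norm := module) h4

theorem dbl_rel (a b : RIdx) (ha : ¬ isNeg a) (hb : ¬ isNeg b) :
    dbl V c (e a) * dbl V c (e b) =
      koszul (par a) (par b) • (dbl V c (e b) * dbl V c (e a)) + dbl V c (brLin (e a) (e b)) := by
  refine LinearMap.ext fun v => ?_
  have e1 : ∀ m, Finsupp.single (RIdx.L m) (1 : ℂ) = L m := fun _ => rfl
  have e2 : ∀ m, Finsupp.single (RIdx.G m) (1 : ℂ) = G m := fun _ => rfl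
  have e3 : Finsupp.single RIdx.C (1 : ℂ) = C := rfl
  rcases a with m | m | _ <;> rcases b with n | n | _ <;>
    simp only [isNeg, not_lt] at ha hb <;>
    simp only [e, e1, e2, e3, par, koszul, LinearMap.add_apply, LinearMap.smul_apply,
      Module.End.mul_apply, brLin_C_left, brLin_C_right, map_zero, LinearMap.zero_apply, dbl_C,
      map_smul]
  · simpa using dbl_L_L c m n ha hb v
  · simpa using dbl_L_G c m n ha hb v
  · simp
  · have h := dbl_L_G c n m hb ha v
    rw [h]
    simp only [brLin_L_G, brLin_G_L, add_comm n m, map_neg, LinearMap.neg_apply]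
    simp
  · simpa using dbl_G_G c m n ha hb v
  all_goals simp

end double
-- Letters, words and the filtration by weight and length
/-- `L_j` or `G_j`, according to the parity. -/
def gen : Bool → ℤ → Ramond
  | false, j => L j
  | true, j => G j

theorem gen_mem (t : Bool) (j : ℤ) : gen t j ∈ part (M := Ramond) (if t then 1 else 0) := by
  cases t
  · exact single_mem (.L j)
  · exact single_mem (.G j)

/-- The coefficient of `L_{j+k}` or `G_{j+k}` in the brackets of basis vectors. -/
def structCoeff : Bool → Bool → ℤ → ℤ → ℂ
  | false, false, j, k => k - j
  | false, true, j, k => k - j / 2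
  | true, false, j, k => -(j - k / 2)
  | true, true, _, _ => -2

theorem exists_brLin_gen (t t' : Bool) (j k : ℤ) : ∃ z : ℂ,
    brLin (gen t j) (gen t' k) = structCoeff t t' j k • gen (xor t t') (j + k) + z • C ∧
      (z ≠ 0 → t = t' ∧ j + k = 0) := by
  cases t <;> cases t'
  · refine ⟨_, brLin_L_L j k, ?_⟩
    intro h; split_ifs at h with h'
    · exact ⟨rfl, h'⟩
    · exact absurd rfl h
  · exact ⟨0, by simp [gen, structCoeff], by simp⟩
  · exact ⟨0, by simp [gen, structCoeff, ← neg_smul, -neg_sub], by simp⟩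
  · refine ⟨_, brLin_G_G j k, ?_⟩
    intro h; split_ifs at h with h'
    · exact ⟨rfl, h'⟩
    · exact absurd rfl h

/-- The indices of `L_j` (`j < 0`) and `G_j` (`j ≤ 0`). -/
def letter (t : Bool) (j : ℤ) : Prop := j < 0 ∨ (j = 0 ∧ t = true)

/-- The weight of `L_j` and `G_j`, for `j ≤ 0`. -/
def wt (j : ℤ) : ℤ := if j = 0 then 1 else -2 * j

section lowering
variable {W : Type*} [AddCommGroup W] [Module ℂ W]

/-- A product of `p` letters of total weight `d`, applied to a vector of `V₀`; the letter `G_0` is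
only allowed as the innermost one. -/
inductive Word (ρ : Ramond →ₗ[ℂ] Module.End ℂ W) (V₀ : Submodule ℂ W) : ℤ → ℤ → W → Prop
  | base (v : W) (hv : v ∈ V₀) : Word ρ V₀ 0 0 v
  | step (t : Bool) (k : ℤ) (hk : letter t k) (d p : ℤ) (u : W) (hu : Word ρ V₀ d p u)
      -- In the model `T` commutes with `G_0` only on `V₀`: on `G_0 V` the square `G_0²` brings in
      -- `L_0`, and `[L_0, L_r] = r L_r`. The other letters may come in any order.
      (h0 : k = 0 → p = 0) :
      Word ρ V₀ (d + wt k) (p + 1) (ρ (gen t k) u)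

/-- The span of the words of weight less than `d`, or of weight `d` and length at most `p`. -/
def filt (ρ : Ramond →ₗ[ℂ] Module.End ℂ W) (V₀ : Submodule ℂ W) (d p : ℤ) : Submodule ℂ W :=
  Submodule.span ℂ {u | ∃ e q, Word ρ V₀ e q u ∧ (e < d ∨ (e ≤ d ∧ q ≤ p))}

/-- How much `L_j` and `G_j` raise the weight. -/
def shift (r : ℤ) (t : Bool) (j : ℤ) : ℤ :=
  -- For `j > r` the cheapest way to survive on `V₀` is to absorb a letter of index `-(j - r)` and
  -- become `L_r`, losing weight `2(j - r)`. Since `G_r` kills `V₀`, the least it can absorb is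
  -- `G_0`, of weight `1`.
  if t = true then
    (if r < j then -2 * (j - r) else if j = r then -1 else if 1 ≤ j then 0 else if j = 0 then 1
      else -2 * j)
  else (if r ≤ j then -2 * (j - r) else if 0 ≤ j then 0 else -2 * j)

/-- How much `L_j` and `G_j` raise the length. -/
def shiftLen (r : ℤ) (t : Bool) (j : ℤ) : ℤ :=
  if t = true then (if r ≤ j then -1 else if 1 ≤ j then 0 else 1)
  else (if r < j then -1 else if 0 ≤ j then 0 else 1)

/-- The assumptions on a representation `ρ` of the Ramond algebra generated by a space `V₀`
which allow to reach `V₀` from any nonzero vector. -/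
structure Lowering (r : ℤ) (ρ : Ramond →ₗ[ℂ] Module.End ℂ W) (V₀ : Submodule ℂ W)
    (T T' : Module.End ℂ W) : Prop where
  two_le : 2 ≤ r
  isRep : IsRep ρ
  C_mem : ∀ v ∈ V₀, ρ C v ∈ V₀
  gen_mem : ∀ t j, 0 ≤ j → ¬ letter t j → ∀ v ∈ V₀, ρ (gen t j) v ∈ V₀
  L_eq_zero : ∀ j, r < j → ∀ v ∈ V₀, ρ (L j) v = 0
  G_eq_zero : ∀ j, r ≤ j → ∀ v ∈ V₀, ρ (G j) v = 0
  T_comm : ∀ t j, letter t j → ∀ w, (j = 0 → w ∈ V₀) → ρ (gen t j) (T w) = T (ρ (gen t j) w)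
  T_eq : ∀ v ∈ V₀, T v = ρ (L r) v
  T'_mem : ∀ v ∈ V₀, T' v ∈ V₀
  T'_T : ∀ w, T' (T w) = w
  T_T' : ∀ w, T (T' w) = w

/-! ### Effect of the generators on the filtration -/

namespace Lowering
variable {r : ℤ} {ρ : Ramond →ₗ[ℂ] Module.End ℂ W} {V₀ : Submodule ℂ W} {T T' : Module.End ℂ W}

theorem wt_pos {t : Bool} {j : ℤ} (hj : letter t j) : 1 ≤ wt j := by
  unfold letter at hj; unfold wt; split_ifs <;> omega

/-- Every letter weighs at least `1`. Hence `filt ρ V₀ n n` contains all words of weight at most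
`n`. -/
theorem len_bounds {e q : ℤ} {u : W} (hu : Word ρ V₀ e q u) : 0 ≤ q ∧ q ≤ e := by
  induction hu with
  | base v hv => simp
  | step t k hk d p u hu h0 ih => have := wt_pos hk; omega

theorem word_zero {e q : ℤ} {u : W} (hu : Word ρ V₀ e q u) (hq : q = 0) : e = 0 ∧ u ∈ V₀ := by
  induction hu with
  | base v hv => exact ⟨rfl, hv⟩
  | step t k hk d p u hu h0 ih => have := len_bounds hu; omega

theorem filt_mono {d p d' p' : ℤ} (h : d < d' ∨ (d ≤ d' ∧ p ≤ p')) :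
    filt ρ V₀ d p ≤ filt ρ V₀ d' p' := by
  refine Submodule.span_mono ?_
  rintro u ⟨e, q, hu, h'⟩
  exact ⟨e, q, hu, by omega⟩

theorem word_mem {e q d p : ℤ} {u : W} (hu : Word ρ V₀ e q u)
    (h : e < d ∨ (e ≤ d ∧ q ≤ p)) : u ∈ filt ρ V₀ d p :=
  Submodule.subset_span ⟨e, q, hu, h⟩

theorem neg_letter_mem {t : Bool} {k : ℤ} (hk : k < 0) {d p : ℤ} {w : W}
    (hw : w ∈ filt ρ V₀ d p) : ρ (gen t k) w ∈ filt ρ V₀ (d + wt k) (p + 1) := by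
  induction hw using Submodule.span_induction with
  | mem u hu =>
    obtain ⟨e, q, hu, h⟩ := hu
    exact word_mem (.step t k (.inl hk) e q u hu (by omega)) (by omega)
  | zero => simp
  | add a b _ _ ha hb => rw [map_add]; exact add_mem ha hb
  | smul z a _ ha => rw [map_smul]; exact Submodule.smul_mem _ _ ha

/-- The sign of the super commutator. -/
def swapSign (t t' : Bool) : ℂ := if t = true ∧ t' = true then -1 else 1

theorem swapSign_mul_self (t t' : Bool) : swapSign t t' * swapSign t t' = 1 := by
  unfold swapSign; split_ifs <;> norm_num

theorem exists_comm (h : IsRep ρ) (t t' : Bool) (j k : ℤ) : ∃ z : ℂ,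
    (∀ w, ρ (gen t j) (ρ (gen t' k) w) = swapSign t t' • ρ (gen t' k) (ρ (gen t j) w) +
      structCoeff t t' j k • ρ (gen (xor t t') (j + k)) w + z • ρ C w) ∧
      (z ≠ 0 → t = t' ∧ j + k = 0) := by
  obtain ⟨z, hz, hz'⟩ := exists_brLin_gen t t' j k
  refine ⟨z, fun w => ?_, hz'⟩
  have := LinearMap.congr_fun (h _ _ _ _ (Ramond.gen_mem t j) (Ramond.gen_mem t' k)) w
  change ρ _ (ρ _ w) = (_ + ρ (brLin _ _)) w at this
  rw [this, hz, map_add, map_smul, map_smul]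
  have hs : koszul (if t then 1 else 0) (if t' then 1 else 0) = swapSign t t' := by
    cases t <;> cases t' <;> simp [koszul, swapSign]
  rw [hs, LinearMap.add_apply, LinearMap.add_apply, ← add_assoc]
  rfl

theorem C_comm (h : IsRep ρ) (t : Bool) (j : ℤ) (w : W) :
    ρ C (ρ (gen t j) w) = ρ (gen t j) (ρ C w) := by
  have := LinearMap.congr_fun (h 0 _ _ _ (single_mem .C) (Ramond.gen_mem t j)) w
  change ρ C (ρ _ w) = (_ + ρ (brLin C _)) w at this
  rw [this, brLin_C_left, map_zero, add_zero]
  cases t <;> simp [koszul] <;> rfl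

theorem C_word (hyp : Lowering r ρ V₀ T T') {e q : ℤ} {u : W} (hu : Word ρ V₀ e q u) :
    Word ρ V₀ e q (ρ C u) := by
  induction hu with
  | base v hv => exact .base _ (hyp.C_mem v hv)
  | step t k hk d p u hu h0 ih => rw [C_comm hyp.isRep]; exact .step _ _ hk _ _ _ ih h0

theorem T_word (hyp : Lowering r ρ V₀ T T') {e q : ℤ} {u : W} (hu : Word ρ V₀ e q u) :
    Word ρ V₀ e q (T u) := by
  induction hu with
  | base v hv =>
    rw [hyp.T_eq v hv]
    refine .base _ (hyp.gen_mem false r (by linarith [hyp.two_le]) ?_ v hv)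
    have := hyp.two_le
    simp [letter]; omega
  | step t k hk d p u hu h0 ih => rw [← hyp.T_comm t k hk _ fun h => (word_zero hu (h0 h)).2]; exact .step _ _ hk _ _ _ ih h0

theorem T'_word (hyp : Lowering r ρ V₀ T T') {e q : ℤ} {u : W} (hu : Word ρ V₀ e q u) :
    Word ρ V₀ e q (T' u) := by
  induction hu with
  | base v hv => exact .base _ (hyp.T'_mem v hv)
  | step t k hk d p u hu h0 ih =>
    have : T' (ρ (gen t k) u) = ρ (gen t k) (T' u) := by
      rw [← hyp.T'_T (ρ (gen t k) (T' u)), ← hyp.T_comm t k hk _ fun h => (word_zero ih (h0 h)).2,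
        hyp.T_T']
    rw [this]; exact .step _ _ hk _ _ _ ih h0

theorem map_filt {S : Module.End ℂ W}
    (hS : ∀ e q u, Word ρ V₀ e q u → Word ρ V₀ e q (S u)) {d p : ℤ} {w : W}
    (hw : w ∈ filt ρ V₀ d p) : S w ∈ filt ρ V₀ d p := by
  induction hw using Submodule.span_induction with
  | mem u hu =>
    obtain ⟨e, q, hu, h⟩ := hu
    exact word_mem (hS e q u hu) h
  | zero => simp
  | add a b _ _ ha hb => rw [map_add]; exact add_mem ha hb
  | smul z a _ ha => rw [map_smul]; exact Submodule.smul_mem _ _ ha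

/-- Lexicographically, merging an operator with a letter raises weight and length no more than
keeping both. So the bracket terms of `gen_word` satisfy the bound of the main term. -/
theorem shift_add (hr : 2 ≤ r) {t t' : Bool} {j k : ℤ} (hj : ¬ letter t j) (hk : letter t' k) :
    shift r (xor t t') (j + k) < shift r t j + wt k ∨
      (shift r (xor t t') (j + k) ≤ shift r t j + wt k ∧
        shiftLen r (xor t t') (j + k) ≤ shiftLen r t j + 1) := by
  unfold letter at hj hk
  cases t <;> cases t' <;> simp [shift, shiftLen, wt] at hj hk ⊢ <;> split_ifs <;> omega

theorem shift_add_neg (hr : 2 ≤ r) {t t' : Bool} {j k : ℤ} (hj : ¬ j < 0) (hk : k < 0) :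
    shift r (xor t t') (j + k) < shift r t j + wt k ∨
      (shift r (xor t t') (j + k) ≤ shift r t j + wt k ∧
        shiftLen r (xor t t') (j + k) ≤ shiftLen r t j + 1) := by
  by_cases h : letter t j
  · obtain ⟨rfl, rfl⟩ := h.resolve_left hj
    cases t' <;> simp [shift, shiftLen, wt] <;> split_ifs <;> omega
  · exact shift_add hr h (.inl hk)

theorem neg_wt_lt_shift (hr : 2 ≤ r) (t : Bool) {j k : ℤ} (hk : k < 0) (h : j + k = 0) :
    0 < shift r t j + wt k := by
  obtain rfl : k = -j := by omega
  cases t <;> simp [shift, wt] <;> split_ifs <;> omega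

theorem shift_letter (hr : 2 ≤ r) {t : Bool} {j : ℤ} (hj : letter t j) :
    shift r t j = wt j ∧ shiftLen r t j = 1 := by
  unfold letter at hj
  cases t <;> simp [shift, shiftLen, wt] at hj ⊢ <;> split_ifs <;> omega

theorem smul_mem_of_ne_zero {z : ℂ} {S : Submodule ℂ W} {w : W} (h : z ≠ 0 → w ∈ S) :
    z • w ∈ S := by
  by_cases hz : z = 0
  · simp [hz]
  · exact S.smul_mem _ (h hz)

theorem gen_base (hyp : Lowering r ρ V₀ T T') {t : Bool} {j : ℤ} (hj : ¬ letter t j) {v : W}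
    (hv : v ∈ V₀) :
    (shift r t j = 0 ∧ shiftLen r t j = 0 ∧ ρ (gen t j) v ∈ V₀) ∨ ρ (gen t j) v = 0 := by
  have hr := hyp.two_le
  suffices h : (shift r t j = 0 ∧ shiftLen r t j = 0 ∧ 0 ≤ j) ∨ ρ (gen t j) v = 0 from
    h.imp_left fun h => ⟨h.1, h.2.1, hyp.gen_mem t j h.2.2 hj v hv⟩
  cases t
  · by_cases h : r < j
    · exact Or.inr (hyp.L_eq_zero j h v hv)
    · left
      simp [letter, shift, shiftLen] at hj ⊢
      split_ifs <;> omega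
  · by_cases h : r ≤ j
    · exact Or.inr (hyp.G_eq_zero j h v hv)
    · left
      simp [letter, shift, shiftLen] at hj ⊢
      split_ifs <;> omega

theorem G_zero_G_zero_mem (hyp : Lowering r ρ V₀ T T') {v : W} (hv : v ∈ V₀) :
    ρ (gen true 0) (ρ (gen true 0) v) ∈ V₀ := by
  obtain ⟨z, hz, -⟩ := exists_comm hyp.isRep true true 0 0
  have h1 := hz v
  have e : swapSign true true = -1 := by simp [swapSign]
  rw [e, add_assoc, neg_one_smul, ← sub_eq_iff_eq_add', sub_neg_eq_add, ← two_smul ℂ] at h1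
  refine (Submodule.smul_mem_iff _ (two_ne_zero' ℂ)).1 (h1 ▸ add_mem ?_ ?_)
  · exact Submodule.smul_mem _ _ (hyp.gen_mem false 0 le_rfl (by simp [letter]) v hv)
  · exact Submodule.smul_mem _ _ (hyp.C_mem v hv)

/-- A letter of negative index is put in front. Any other operator moves inward; each bracket is
again a basis vector, up to a central term, acting on a shorter word, hence the induction with `t`
and `j` free. `G_0` may not precede a nonempty word, so it too moves inward, until it reaches `V₀`
or meets an innermost `G_0`, where `G_0²` preserves `V₀`. -/
theorem gen_word (hyp : Lowering r ρ V₀ T T') {e q : ℤ} {u : W} (hu : Word ρ V₀ e q u)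
    (t : Bool) (j : ℤ) :
    ρ (gen t j) u ∈ filt ρ V₀ (e + shift r t j) (q + shiftLen r t j) := by
  have hr := hyp.two_le
  induction hu generalizing t j with
  | base v hv =>
    by_cases hj : letter t j
    · have := shift_letter hr hj
      exact word_mem (.step t j hj 0 0 v (.base v hv) fun _ => rfl) (by omega)
    · rcases hyp.gen_base hj hv with hz | hz
      · exact word_mem (.base _ hz.2.2) (by omega)
      · rw [hz]; exact zero_mem _
  | step t' k hk d p u hu h0 ih =>
    by_cases hj : j < 0
    · have := shift_letter hr (t := t) (.inl hj)
      exact word_mem (.step t j (.inl hj) _ _ _ (.step t' k hk d p u hu h0) (by omega)) (by omega)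
    by_cases hk0 : k < 0
    · obtain ⟨z, hz, hz'⟩ := exists_comm hyp.isRep t t' j k
      rw [hz]
      refine add_mem (add_mem (Submodule.smul_mem _ _ ?_) (Submodule.smul_mem _ _ ?_))
        (smul_mem_of_ne_zero fun h => ?_)
      · exact filt_mono (by omega) (neg_letter_mem hk0 (ih t j))
      · have := shift_add_neg hr (t := t) (t' := t') hj hk0
        exact filt_mono (by omega) (ih (xor t t') (j + k))
      · obtain ⟨rfl, h0⟩ := hz' h
        have := neg_wt_lt_shift hr t hk0 h0
        exact word_mem (hyp.C_word hu) (by omega)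
    · obtain ⟨rfl, rfl⟩ : k = 0 ∧ t' = true := hk.resolve_left hk0
      obtain rfl := h0 rfl
      obtain ⟨rfl, hu0⟩ := word_zero hu rfl
      by_cases hj' : letter t j
      · obtain ⟨rfl, rfl⟩ := hj'.resolve_left hj
        have hs := shift_letter hr (t := true) (.inr ⟨rfl, rfl⟩)
        have hw : wt 0 = 1 := rfl
        exact word_mem (.base _ (hyp.G_zero_G_zero_mem hu0)) (by omega)
      · obtain ⟨z, hz, hz'⟩ := exists_comm hyp.isRep t true j 0
        rw [hz]
        refine add_mem (add_mem (Submodule.smul_mem _ _ ?_) (Submodule.smul_mem _ _ ?_))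
          (smul_mem_of_ne_zero fun h => ?_)
        · rcases hyp.gen_base hj' hu0 with hz | hz
          · exact word_mem (.step true 0 hk _ _ _ (.base _ hz.2.2) fun _ => rfl) (by omega)
          · rw [hz, map_zero]; exact zero_mem _
        · have := shift_add hr hj' hk
          exact filt_mono (by omega) (ih (xor t true) (j + 0))
        · obtain ⟨rfl, h0⟩ := hz' h
          exact absurd (.inr ⟨by omega, rfl⟩) hj'

theorem gen_filt (hyp : Lowering r ρ V₀ T T') {d p : ℤ} {w : W} (hw : w ∈ filt ρ V₀ d p)
    (t : Bool) (j : ℤ) :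
    ρ (gen t j) w ∈ filt ρ V₀ (d + shift r t j) (p + shiftLen r t j) := by
  induction hw using Submodule.span_induction with
  | mem u hu =>
    obtain ⟨e, q, hu, h⟩ := hu
    exact filt_mono (by omega) (hyp.gen_word hu t j)
  | zero => simp
  | add a b _ _ ha hb => rw [map_add]; exact add_mem ha hb
  | smul z a _ ha => rw [map_smul]; exact Submodule.smul_mem _ _ ha

theorem letter_mem (hyp : Lowering r ρ V₀ T T') {t : Bool} {k : ℤ} (hk : letter t k) {d p : ℤ}
    {w : W} (hw : w ∈ filt ρ V₀ d p) : ρ (gen t k) w ∈ filt ρ V₀ (d + wt k) (p + 1) := by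
  have := shift_letter hyp.two_le hk
  exact filt_mono (by omega) (hyp.gen_filt hw t k)

/-- The leading part of `L_r` is `T`. -/
theorem L_sub_T_mem (hyp : Lowering r ρ V₀ T T') {e q : ℤ} {u : W} (hu : Word ρ V₀ e q u) :
    ρ (L r) u - T u ∈ filt ρ V₀ e (q - 1) := by
  have hr := hyp.two_le
  induction hu with
  | base v hv => simp [hyp.T_eq v hv]
  | step t k hk d p u hu h0 ih =>
    obtain ⟨z, hz, hz'⟩ := exists_comm hyp.isRep false t r k
    change ρ (gen false r) _ - _ ∈ _
    have e1 : swapSign false t = 1 := by simp [swapSign]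
    have e2 : ∀ x y : W, ρ (gen t k) (ρ (gen false r) u) + x + y - ρ (gen t k) (T u) =
        ρ (gen t k) (ρ (L r) u - T u) + x + y := by
      intro x y
      rw [show L r = gen false r from rfl, map_sub]
      abel
    rw [hz, e1, one_smul, ← hyp.T_comm t k hk _ fun h => (word_zero hu (h0 h)).2, e2]
    refine add_mem (add_mem ?_ (Submodule.smul_mem _ _ ?_)) (smul_mem_of_ne_zero fun h => ?_)
    · exact filt_mono (by omega) (hyp.letter_mem hk ih)
    -- The bracket of `L_r` with a letter of index `k` has index `r + k`, and its `shift` is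
    -- strictly below `wt k`; for `k = 0` it is `G_r`, which lowers the weight.
    · refine filt_mono ?_ (hyp.gen_word hu (xor false t) (r + k))
      unfold letter at hk
      cases t <;> simp [shift, shiftLen, wt] at hk ⊢ <;> split_ifs <;> omega
    · have := wt_pos hk
      exact word_mem (hyp.C_word hu) (by omega)

/-! ### The Euler operator and the descent to `V₀` -/

variable (r ρ) in
/-- The terms of the Euler operator. -/
def eulerCoeff (t : Bool) (i : ℕ) : ℂ :=
  -- Inverses of the coefficients in `[G_{r+i}, G_{-i}] = -2 L_r` and `[L_{r+i}, L_{-i}] = -(r + 2i)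
  -- L_r`. The term with `L_0` is dropped because `L_0` is not a letter.
  if t = true then -1 / 2 else if i = 0 then 0 else -1 / (r + 2 * i)

variable (r ρ) in
/-- The Euler operator, whose leading part is the length operator times `L_r`. -/
def euler (D : ℕ) : Module.End ℂ W :=
  ∑ i ∈ Finset.range (D + 1), ∑ t : Bool,
    eulerCoeff r t i • (ρ (gen t (-i)) * ρ (gen t (r + i)))

/-- The operator of index `r + i` removes weight `wt (-i)` and one unit of length. The bracket of
the letter of index `-i` with the new letter then merges two letters into one, so it falls below the
leading length `q + 1`; only the bracket of the new letter with the inner operator can matter. -/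
theorem gen_gen_gen_sub_mem (hyp : Lowering r ρ V₀ T T') {e q : ℤ} {u : W}
    (hu : Word ρ V₀ e q u) {t t' : Bool} {i k : ℤ} (hi : letter t (-i)) (hk : letter t' k) :
    ρ (gen t (-i)) (ρ (gen t (r + i)) (ρ (gen t' k) u)) -
        ρ (gen t' k) (ρ (gen t (-i)) (ρ (gen t (r + i)) u)) -
      structCoeff t t' (r + i) k • ρ (gen t (-i)) (ρ (gen (xor t t') (r + i + k)) u) ∈
      filt ρ V₀ (e + wt k) q := by
  have hr := hyp.two_le
  obtain ⟨z, hz, hz'⟩ := exists_comm hyp.isRep t t' (r + i) k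
  obtain ⟨y, hy, hy'⟩ := exists_comm hyp.isRep t t' (-i) k
  have hs : shift r t (r + i) = - wt (-i) ∧ shiftLen r t (r + i) = -1 := by
    unfold letter at hi
    cases t <;> simp [shift, shiftLen, wt] at hi ⊢ <;> split_ifs <;> omega
  have h1 := hyp.gen_word hu t (r + i)
  set x := ρ (gen t (r + i)) u with hx
  have key : ρ (gen t (-i)) (ρ (gen t (r + i)) (ρ (gen t' k) u)) -
        ρ (gen t' k) (ρ (gen t (-i)) x) -
      structCoeff t t' (r + i) k • ρ (gen t (-i)) (ρ (gen (xor t t') (r + i + k)) u) =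
      swapSign t t' • structCoeff t t' (-i) k • ρ (gen (xor t t') (-i + k)) x +
        swapSign t t' • y • ρ C x + z • ρ (gen t (-i)) (ρ C u) := by
    rw [hz, ← hx, map_add, map_add, map_smul, map_smul, map_smul, hy, smul_add, smul_add,
      smul_smul, swapSign_mul_self, one_smul]
    abel
  rw [key]
  have hi1 := wt_pos hi
  have hk1 := wt_pos hk
  refine add_mem (add_mem (Submodule.smul_mem _ _ (Submodule.smul_mem _ _ ?_))
    (Submodule.smul_mem _ _ (Submodule.smul_mem _ _ ?_))) (smul_mem_of_ne_zero fun h => ?_)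
  · refine filt_mono ?_ (hyp.gen_filt h1 (xor t t') (-i + k))
    rw [hs.1, hs.2]
    unfold letter at hi hk
    cases t <;> cases t' <;> simp [shift, shiftLen, wt] at hi hk ⊢ <;> split_ifs <;> omega
  · exact filt_mono (by omega) (map_filt (fun _ _ _ => hyp.C_word) h1)
  · have h0 := hz' h
    refine filt_mono ?_ (hyp.letter_mem hi (word_mem (p := q) (d := e) (hyp.C_word hu) (by omega)))
    unfold letter at hi hk
    unfold wt
    left
    split_ifs <;> omega

/-- If `i > -k`, the bracket has index above `r`, so it lowers the length while the weight stays
within the bound. If `i = -k`, the types differ and the bracket is `G_r`, which lowers the weight.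
If `i < -k`, the letter put back and the bracket together weigh less than the letter of index `k`.
-/
theorem gen_gen_mem (hyp : Lowering r ρ V₀ T T') {e q : ℤ} {u : W}
    (hu : Word ρ V₀ e q u) {t t' : Bool} {i k : ℤ} (hi : letter t (-i)) (hk : letter t' k)
    (hne : ¬ (t = t' ∧ k = -i)) :
    ρ (gen t (-i)) (ρ (gen (xor t t') (r + i + k)) u) ∈ filt ρ V₀ (e + wt k) q := by
  have hr := hyp.two_le
  refine filt_mono ?_ (hyp.letter_mem hi (hyp.gen_word hu (xor t t') (r + i + k)))
  unfold letter at hi hk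
  cases t <;> cases t' <;> simp [shift, shiftLen, wt] at hi hk hne ⊢ <;> split_ifs <;> omega

/-- The matching term turns the new letter into that letter applied after `L_r`, with coefficient
normalized to `1`, and `L_r` may be replaced by `T` modulo shorter words. Every other term commutes
with the letter to leading order. -/
theorem eulerTerm (hyp : Lowering r ρ V₀ T T') {e q : ℤ} {u : W}
    (hu : Word ρ V₀ e q u) (t t' : Bool) (i : ℕ) {k : ℤ} (hk : letter t' k)
    (h0 : k = 0 → u ∈ V₀) :
    eulerCoeff r t i • ρ (gen t (-i)) (ρ (gen t (r + i)) (ρ (gen t' k) u)) -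
      ρ (gen t' k) (eulerCoeff r t i • ρ (gen t (-i)) (ρ (gen t (r + i)) u)) -
      (if t = t' ∧ k = -i then T (ρ (gen t' k) u) else 0) ∈ filt ρ V₀ (e + wt k) q := by
  have hr := hyp.two_le
  by_cases hi : letter t (-i)
  · have h1 := hyp.gen_gen_gen_sub_mem hu hi hk
    rw [map_smul, ← smul_sub]
    by_cases hne : t = t' ∧ k = -i
    · obtain ⟨rfl, rfl⟩ := hne
      have h2 := hyp.letter_mem hi (hyp.L_sub_T_mem hu)
      rw [sub_add_cancel, map_sub, hyp.T_comm _ _ hi _ h0] at h2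
      have h3 : eulerCoeff r t i * structCoeff t t (r + i) (-i) = 1 := by
        cases t
        · have hi0 : i ≠ 0 := by
            rintro rfl
            simp [letter] at hi
          have : (r + 2 * i : ℂ) ≠ 0 := by
            have : (r + 2 * i : ℤ) ≠ 0 := by omega
            exact_mod_cast this
          simp only [eulerCoeff, structCoeff, hi0]
          push_cast
          field_simp
          simp
          ring
        · simp [eulerCoeff, structCoeff]
      rw [Bool.xor_self, add_neg_cancel_right] at h1
      rw [if_pos ⟨rfl, rfl⟩]
      have h4 := add_mem (Submodule.smul_mem _ (eulerCoeff r t i) h1) h2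
      rw [smul_sub _ _ (structCoeff _ _ _ _ • _), smul_smul, h3, one_smul] at h4
      convert h4 using 1
      change _ = _ - ρ (gen t (-i)) (ρ (L r) u) + (ρ (gen t (-i)) (ρ (L r) u) - _)
      abel
    · rw [if_neg hne, sub_zero]
      refine Submodule.smul_mem _ _ ?_
      have h2 := hyp.gen_gen_mem hu hi hk hne
      have h3 := add_mem h1 (Submodule.smul_mem _ (structCoeff t t' (r + i) k) h2)
      rwa [sub_add_cancel] at h3
  · have hi' : t = false ∧ i = 0 := by
      cases t <;> simp [letter] at hi ⊢ <;> omega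
    obtain ⟨rfl, rfl⟩ := hi'
    have : ¬ (false = t' ∧ k = -((0 : ℕ) : ℤ)) := by
      rintro ⟨rfl, rfl⟩
      simp [letter] at hk
    rw [if_neg this]
    simp [eulerCoeff]

/-- All terms vanish on `V₀`, and each letter matches exactly one term of the sum, contributing one
`T`. The bound `e ≤ D` ensures that the sum reaches the index of every letter. -/
theorem euler_word (hyp : Lowering r ρ V₀ T T') {D : ℕ} {e q : ℤ} {u : W}
    (hu : Word ρ V₀ e q u) (hD : e ≤ D) :
    euler r ρ D u - (q : ℂ) • T u ∈ filt ρ V₀ e (q - 1) := by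
  induction hu with
  | base v hv =>
    have : euler r ρ D v = 0 := by
      simp only [euler, LinearMap.sum_apply, LinearMap.smul_apply, Module.End.mul_apply]
      refine Finset.sum_eq_zero fun i _ => Finset.sum_eq_zero fun t _ => ?_
      cases t
      · by_cases hi : i = 0
        · simp [eulerCoeff, hi]
        · have := hyp.L_eq_zero (r + i) (by omega) v hv
          simp [gen, this]
      · have := hyp.G_eq_zero (r + i) (by omega) v hv
        simp [gen, this]
    simp [this]
  | step t' k hk d p u hu h0 ih =>
    have hk1 := wt_pos hk
    have hd := len_bounds hu
    have hu0 : k = 0 → u ∈ V₀ := fun h => (word_zero hu (h0 h)).2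
    have ih := hyp.letter_mem hk (ih (by omega))
    have hsum : ∑ i ∈ Finset.range (D + 1), ∑ t : Bool,
        (if t = t' ∧ k = -(i : ℤ) then T (ρ (gen t' k) u) else 0) = T (ρ (gen t' k) u) := by
      have hk0 : k ≤ 0 ∧ -k ≤ D := by
        unfold letter at hk; unfold wt at hD; split_ifs at hD <;> omega
      rw [Finset.sum_eq_single (-k).toNat, Finset.sum_eq_single t']
      · rw [if_pos]; refine ⟨rfl, ?_⟩; omega
      · intro t _ ht; simp [ht]
      · simp
      · intro i _ hi
        refine Finset.sum_eq_zero fun t _ => if_neg ?_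
        omega
      · intro h; exfalso; simp at h; omega
    have hs : euler r ρ D (ρ (gen t' k) u) - ρ (gen t' k) (euler r ρ D u) - T (ρ (gen t' k) u) ∈
        filt ρ V₀ (d + wt k) p := by
      rw [← hsum]
      simp only [euler, LinearMap.sum_apply, LinearMap.smul_apply, Module.End.mul_apply, map_sum,
        ← Finset.sum_sub_distrib]
      exact sum_mem fun i _ => sum_mem fun t _ => hyp.eulerTerm hu t t' i hk hu0
    rw [add_sub_cancel_right]
    rw [sub_add_cancel] at ih
    have := add_mem hs ih
    rw [map_sub, map_smul, hyp.T_comm _ _ hk _ hu0] at this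
    convert this using 1
    push_cast
    module

/-- A spanning word of length `q ≠ p` has weight below `d` or length at most `p - 1`, so replacing
`q` by `p` changes only lower terms. -/
theorem euler_filt (hyp : Lowering r ρ V₀ T T') {D : ℕ} {d p : ℤ} {w : W}
    (hw : w ∈ filt ρ V₀ d p) (hD : d ≤ D) :
    euler r ρ D w - (p : ℂ) • T w ∈ filt ρ V₀ d (p - 1) := by
  induction hw using Submodule.span_induction with
  | mem u hu =>
    obtain ⟨e, q, hu, h⟩ := hu
    have h1 := filt_mono (d' := d) (p' := p - 1) (by omega) (hyp.euler_word hu (D := D) (by omega))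
    have h2 : ((q : ℂ) - p) • T u ∈ filt ρ V₀ d (p - 1) := by
      refine smul_mem_of_ne_zero fun hne => word_mem (hyp.T_word hu) ?_
      have : q ≠ p := by rintro rfl; simp at hne
      omega
    convert add_mem h1 h2 using 1
    module
  | zero => simp
  | add a b _ _ ha hb => convert add_mem ha hb using 1; simp only [map_add]; module
  | smul z a _ ha => convert Submodule.smul_mem _ z ha using 1; simp only [map_smul]; module

theorem filt_zero_le {p : ℤ} : filt ρ V₀ 0 p ≤ V₀ := by
  refine Submodule.span_le.2 ?_
  rintro u ⟨e, q, hu, h⟩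
  have := len_bounds hu
  exact (word_zero hu (by omega)).2

/-- The vectors killed by all `L_{r+i}` (`i > 0`) and `G_{r+i}` (`i ≥ 0`) lie in `V₀`. -/
theorem mem_of_forall_eq_zero (hyp : Lowering r ρ V₀ T T') {w : W}
    (h0 : ∀ (t : Bool) (i : ℕ), letter t (-i) → ρ (gen t (r + i)) w = 0) (n : ℕ)
    (hw : w ∈ filt ρ V₀ n n) : w ∈ V₀ := by
  have hE : ∀ D, euler r ρ D w = 0 := by
    intro D
    simp only [euler, LinearMap.sum_apply, LinearMap.smul_apply, Module.End.mul_apply]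
    refine Finset.sum_eq_zero fun i _ => Finset.sum_eq_zero fun t _ => ?_
    by_cases hi : letter t (-i)
    · rw [h0 t i hi, map_zero, smul_zero]
    · have hi' : t = false ∧ i = 0 := by
        cases t <;> simp [letter] at hi ⊢ <;> omega
      simp [eulerCoeff, hi']
  induction n with
  | zero => exact filt_zero_le hw
  | succ n ih =>
    have key : ∀ p : ℕ, w ∈ filt ρ V₀ (n + 1 : ℕ) p → w ∈ filt ρ V₀ (n + 1 : ℕ) 0 := by
      intro p
      induction p with
      | zero => exact id
      | succ p ihp =>
        intro hp
        refine ihp ?_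
        -- The Euler operator kills `w` and equals `(p + 1) T` to leading order, so `T w` has length
        -- at most `p`. Then so has `w`, because `T'` preserves the filtration.
        have h1 := hyp.euler_filt hp le_rfl
        rw [hE, zero_sub, neg_mem_iff] at h1
        have h2 : ((p + 1 : ℕ) : ℂ) ≠ 0 := by exact_mod_cast Nat.succ_ne_zero p
        have h3 := (Submodule.smul_mem_iff _ (by exact_mod_cast h2)).1 h1
        have h4 := map_filt (fun _ _ _ => hyp.T'_word) h3
        rw [hyp.T'_T] at h4
        simpa using h4
    refine ih ?_
    refine (Submodule.span_le.2 ?_ : filt ρ V₀ (n + 1 : ℕ) 0 ≤ filt ρ V₀ n n) (key _ hw)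
    rintro u ⟨e, q, hu, h⟩
    have hb := len_bounds hu
    have hz := word_zero hu
    -- A word of length `0` has weight `0`; a word of weight at most `n` has length at most `n`.
    refine word_mem hu ?_
    push_cast at h
    omega

/-- Every nonzero invariant subspace meets `V₀`, if `V₀` generates. -/
theorem exists_ne_zero_mem (hyp : Lowering r ρ V₀ T T') (hgen : ∀ w, ∃ n : ℕ, w ∈ filt ρ V₀ n n)
    (S : Submodule ℂ W) (hS : ∀ x, ∀ w ∈ S, ρ x w ∈ S) (hS0 : S ≠ ⊥) :
    ∃ v ∈ V₀, v ∈ S ∧ v ≠ 0 := by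
  have hr := hyp.two_le
  obtain ⟨w, hwS, hw0⟩ := Submodule.exists_mem_ne_zero_of_ne_bot hS0
  have hex : ∃ n : ℕ, ∃ w ∈ S, w ≠ 0 ∧ w ∈ filt ρ V₀ n n := by
    obtain ⟨n, hn⟩ := hgen w
    exact ⟨n, w, hwS, hw0, hn⟩
  classical
  obtain ⟨n, ⟨w, hwS, hw0, hwn⟩, hmin⟩ := Nat.findX hex
  refine ⟨w, ?_, hwS, hw0⟩
  cases n with
  | zero => exact filt_zero_le hwn
  | succ n =>
    refine hyp.mem_of_forall_eq_zero (fun t i hi => ?_) _ hwn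
    by_contra hne
    -- These operators lower the weight by at least `1` and the length by `1`, so a nonzero image
    -- would contradict the minimality of the weight.
    refine hmin n (Nat.lt_succ_self n) ⟨_, hS _ _ hwS, hne, ?_⟩
    refine filt_mono ?_ (hyp.gen_filt hwn t (r + i))
    unfold letter at hi
    cases t <;> simp [shift, shiftLen] at hi ⊢ <;> split_ifs <;> omega

end Lowering
end lowering
end Ramond

/-! ### Universal property and simplicity of induced modules -/

section
variable {𝔤 : Type*} [AddCommGroup 𝔤] [Module ℂ 𝔤] [SuperSpace 𝔤] [LieSuperalgebra 𝔤]

theorem act_isRep (M : Type*) [AddCommGroup M] [Module ℂ M] [SuperSpace M] [LieSupermodule 𝔤 M] :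
    IsRep (act : 𝔤 →ₗ[ℂ] Module.End ℂ M) := fun i j x y hx hy =>
  LinearMap.ext fun v => sub_eq_iff_eq_add'.1 (LieSupermodule.act_br i j x y v hx hy)

theorem Env.incl_ι (𝔟 : Subalg 𝔤) (x : 𝔟.space) :
    Env.incl 𝔟 (Env.ι x) = Env.ι (x : 𝔤) :=
  Env.lift_ι _ _ x

theorem Env.rep_ι (V : Type*) [AddCommGroup V] [Module ℂ V] [SuperSpace V]
    [LieSupermodule 𝔤 V] (x : 𝔤) : Env.rep 𝔤 V (Env.ι x) = act x :=
  Env.lift_ι (A := Module.End ℂ V) _ _ x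

/-- The augmentation `U(𝔤) → ℂ`, which kills `𝔤`, gives a left inverse of `v ↦ 1 ⊗ v`. -/
theorem Env.one_tmul_eq_zero_iff {X : Type*} [AddCommGroup X] [Module ℂ X] {v : X} :
    (1 : Env 𝔤) ⊗ₜ[ℂ] v = 0 ↔ v = 0 := by
  refine ⟨fun h => ?_, fun h => by simp [h]⟩
  let aug : Env 𝔤 →ₐ[ℂ] ℂ := Env.lift 0 (by simp)
  have := congrArg (TensorProduct.lift ((LinearMap.lsmul ℂ X) ∘ₗ aug.toLinearMap)) h
  simpa using this

end

namespace Ind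
section
variable {𝔤 : Type*} [AddCommGroup 𝔤] [Module ℂ 𝔤] [SuperSpace 𝔤] [LieSuperalgebra 𝔤]
  (𝔟 : Subalg 𝔤) (V : Type*) [AddCommGroup V] [Module ℂ V] [SuperSpace V]
  [LieSupermodule 𝔟.space V]

/-- The map `v ↦ 1 ⊗ v`. -/
def base : V →ₗ[ℂ] Ind 𝔟 V where
  toFun v := tmul 𝔟 V 1 v
  map_add' := tmul_add_right 𝔟 V 1
  map_smul' z v := by simpa using tmul_smul_smul 𝔟 V 1 z 1 v

variable {V}

theorem act_base (x : 𝔟.space) (v : V) :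
    act (x : 𝔤) (base 𝔟 V v) = base 𝔟 V (act x v) := by
  have h : (1 * Env.incl 𝔟 (Env.ι x)) ⊗ₜ[ℂ] v - 1 ⊗ₜ[ℂ] (Env.rep 𝔟.space V (Env.ι x) v) ∈
      balanced 𝔟 V := Submodule.subset_span ⟨1, Env.ι x, v, rfl⟩
  have h2 := (Submodule.Quotient.eq _).2 h
  rw [one_mul, Env.incl_ι, Env.rep_ι] at h2
  refine Eq.trans ?_ h2
  change Submodule.Quotient.mk (Env.ι (x : 𝔤) • (1 ⊗ₜ[ℂ] v)) = _
  rw [TensorProduct.smul_tmul', smul_eq_mul, mul_one]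

theorem smul_base (u : Env 𝔤) (v : V) : u • base 𝔟 V v = tmul 𝔟 V u v := by
  change Submodule.Quotient.mk (u • (1 ⊗ₜ[ℂ] v)) = _
  rw [TensorProduct.smul_tmul', smul_eq_mul, mul_one]
  rfl

theorem induct {P : Ind 𝔟 V → Prop} (h : ∀ (u : Env 𝔤) v, P (u • base 𝔟 V v))
    (hadd : ∀ a b, P a → P b → P (a + b)) (w : Ind 𝔟 V) : P w := by
  obtain ⟨t, rfl⟩ := Submodule.Quotient.mk_surjective _ w
  induction t using TensorProduct.induction_on with
  | zero => simpa using h 0 0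
  | tmul u v => have := h u v; rwa [smul_base] at this
  | add a b ha hb => rw [Submodule.Quotient.mk_add]; exact hadd _ _ ha hb

theorem base_mem_part {i : ZMod 2} {v : V} (hv : v ∈ part i) :
    base 𝔟 V v ∈ part (M := Ind 𝔟 V) i :=
  Submodule.subset_span ⟨0, i, 1, v, zero_add i, Env.one_mem, hv, rfl⟩

/-- The universal property of the induced module. -/
theorem exists_hom {W : Type*} [AddCommGroup W] [Module ℂ W] {ρ : 𝔤 →ₗ[ℂ] Module.End ℂ W}
    (hρ : IsRep ρ) (f : V →ₗ[ℂ] W) (hf : ∀ (x : 𝔟.space) v, ρ x (f v) = f (act x v)) :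
    ∃ Ψ : Ind 𝔟 V →ₗ[ℂ] W, (∀ v, Ψ (base 𝔟 V v) = f v) ∧ ∀ x w, Ψ (act x w) = ρ x (Ψ w) := by
  let lam : Env 𝔤 →ₐ[ℂ] Module.End ℂ W := Env.lift ρ hρ
  have hlam : ∀ x : 𝔤, lam (Env.ι x) = ρ x := fun x => Env.lift_ι _ _ x
  let Ψ₀ : Env 𝔤 ⊗[ℂ] V →ₗ[ℂ] W := TensorProduct.lift ((lam.toLinearMap.flip ∘ₗ f).flip)
  have h1 : ∀ u v, Ψ₀ (u ⊗ₜ v) = lam u (f v) := fun u v => rfl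
  have h2 : ∀ (u : Env 𝔤) t, Ψ₀ (u • t) = lam u (Ψ₀ t) := by
    intro u t
    induction t using TensorProduct.induction_on with
    | zero => simp
    | add a b ha hb => simp only [smul_add, map_add, ha, hb]
    | tmul a v =>
      rw [TensorProduct.smul_tmul', smul_eq_mul, h1, h1, map_mul, Module.End.mul_apply]
  have h3 : ∀ (b : Env 𝔟.space) v, lam (Env.incl 𝔟 b) (f v) = f (Env.rep 𝔟.space V b v) := by
    intro b
    induction b using Env.induct with
    | h1 z => intro v; simp [Algebra.algebraMap_eq_smul_one]
    | hι x =>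
      intro v
      rw [Env.incl_ι, Env.rep_ι, hlam]
      exact hf x v
    | hmul a b ha hb => intro v; simp [ha, hb]
    | hadd a b ha hb => intro v; simp [ha, hb]
  have h4 : ∀ t ∈ balanced 𝔟 V, Ψ₀ t = 0 := by
    intro t ht
    induction ht using Submodule.span_induction with
    | mem t ht =>
      obtain ⟨u, b, v, rfl⟩ := ht
      rw [map_sub, h1, h1, map_mul, Module.End.mul_apply, h3, sub_self]
    | zero => simp
    | add a b _ _ ha hb => rw [map_add, ha, hb, add_zero]
    | smul u a _ ha => rw [h2, ha, map_zero]
  let Ψ : Ind 𝔟 V →ₗ[ℂ] W := (((balanced 𝔟 V).restrictScalars ℂ).liftQ Ψ₀ h4) ∘ₗ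
    (Submodule.Quotient.restrictScalarsEquiv ℂ (balanced 𝔟 V)).symm.toLinearMap
  have h5 : ∀ t, Ψ (Submodule.Quotient.mk t) = Ψ₀ t := fun t => rfl
  refine ⟨Ψ, fun v => ?_, fun x w => ?_⟩
  · change Ψ (Submodule.Quotient.mk (1 ⊗ₜ v)) = _
    rw [h5, h1, map_one, Module.End.one_apply]
  · obtain ⟨t, rfl⟩ := Submodule.Quotient.mk_surjective _ w
    change Ψ (Submodule.Quotient.mk (Env.ι x • t)) = _
    rw [h5, h5, h2, hlam]

/-- A criterion for the simplicity of an induced module. -/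
theorem isSimple (hV : IsSimple 𝔟.space V) (h0 : ∀ v : V, base 𝔟 V v = 0 → v = 0)
    (h : ∀ N : Submodule ℂ (Ind 𝔟 V), (∀ (x : 𝔤) w, w ∈ N → act x w ∈ N) → N ≠ ⊥ →
      ∃ v, base 𝔟 V v ∈ N ∧ v ≠ 0) : IsSimple 𝔤 (Ind 𝔟 V) := by
  obtain ⟨hnt, hV⟩ := hV
  refine ⟨?_, fun N hgr hN => or_iff_not_imp_left.2 fun hne => ?_⟩
  · obtain ⟨v, hv⟩ := exists_ne (0 : V)
    exact ⟨base 𝔟 V v, 0, fun h => hv (h0 v h)⟩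
  obtain ⟨v, hvN, hv⟩ := h N hN hne
  have hK : N.comap (base 𝔟 V) = ⊤ := by
    refine (hV _ ?_ ?_).resolve_left ?_
    · intro v hv
      obtain ⟨a, ha, b, hb, rfl⟩ := exists_parts v
      obtain ⟨p, hp, q, hq, hpq⟩ := Submodule.mem_sup.1 (hgr hv)
      have ha' := base_mem_part 𝔟 ha
      have hb' := base_mem_part 𝔟 hb
      -- The left side is even and the right side is odd, so both vanish: the homogeneous parts of
      -- `1 ⊗ v` in `N` come from those of `v`.
      have e : p - base 𝔟 V a = base 𝔟 V b - q := by
        rw [sub_eq_sub_iff_add_eq_add, hpq, map_add, add_comm]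
      have e0 : p - base 𝔟 V a = 0 :=
        (Submodule.disjoint_def.1 (SuperSpace.isCompl (M := Ind 𝔟 V)).disjoint) _
          (sub_mem hp.2 ha') (e ▸ sub_mem hb' hq.2)
      rw [e0] at e
      refine Submodule.mem_sup.2 ⟨a, ⟨?_, ha⟩, b, ⟨?_, hb⟩, rfl⟩
      · change base 𝔟 V a ∈ N
        rw [← sub_eq_zero.1 e0]; exact hp.1
      · change base 𝔟 V b ∈ N
        rw [sub_eq_zero.1 e.symm]; exact hq.1
    · intro x v hv
      change base 𝔟 V (act x v) ∈ N
      rw [← act_base]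
      exact hN _ _ hv
    · intro hbot
      exact hv ((Submodule.mem_bot ℂ).1 (hbot ▸ hvN))
  have hu : ∀ (u : Env 𝔤) w, w ∈ N → u • w ∈ N := by
    intro u
    induction u using Env.induct with
    | h1 z => intro w hw; rw [algebraMap_smul]; exact N.smul_mem z hw
    | hι x => intro w hw; exact hN x w hw
    | hmul a b ha hb => intro w hw; rw [mul_smul]; exact ha _ (hb _ hw)
    | hadd a b ha hb => intro w hw; rw [add_smul]; exact add_mem (ha _ hw) (hb _ hw)
  refine eq_top_iff.2 fun w _ => ?_
  induction w using induct with
  | h u v => exact hu u _ (show v ∈ N.comap (base 𝔟 V) from hK ▸ Submodule.mem_top)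
  | hadd a b ha hb => exact add_mem (ha trivial) (hb trivial)

end
end Ind

/-! ### Consequences of the hypotheses on `V` -/

namespace Ramond

variable {V : Type*} [AddCommGroup V] [Module ℂ V] [SuperSpace V] [LieSupermodule B.space V]
  {r : ℤ} {c : ℂ}

theorem opL_of_gt (hL : ∀ (m : ℤ) (_ : r < m) (h0 : 0 ≤ m) (v : V), act (LB m h0) v = 0) {m : ℤ}
    (hm : r < m) (v : V) : opL V m v = 0 := by
  by_cases h : 0 ≤ m
  · rw [opL_of_nonneg h, hL m hm h]
  · rw [opL_of_neg (by omega), LinearMap.zero_apply]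

/-- If `G_r` acts by zero then so do all `G_m` with `m ≥ r`. -/
theorem opG_of_ge (hr : 2 ≤ r) (hG : ∀ v : V, opG V r v = 0) {m : ℤ} (hm : r ≤ m) (v : V) :
    opG V m v = 0 := by
  -- `[L_{m-r}, G_r] = ((3r - m)/2) G_m` settles every `m` except `3r`; there `[L_1, G_{3r-1}] = (3r
  -- - 3/2) G_{3r}` is used.
  have key : ∀ m : ℤ, r ≤ m → m ≠ 3 * r → ∀ v : V, opG V m v = 0 := by
    intro m hm hm3 v
    have h := opL_opG (m := m - r) (n := r) (by omega) (by omega) v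
    rw [hG, hG, map_zero, zero_add, sub_add_cancel] at h
    refine (smul_eq_zero.1 h.symm).resolve_left fun h0 => hm3 ?_
    push_cast at h0
    have : (m : ℂ) = (3 * r : ℤ) := by push_cast; linear_combination (-2 : ℂ) * h0
    exact_mod_cast this
  by_cases h3 : m = 3 * r
  · subst h3
    have h := opL_opG (m := 1) (n := 3 * r - 1) (by omega) (by omega) v
    rw [key _ (by omega) (by omega), key _ (by omega) (by omega), map_zero, zero_add,
      add_sub_cancel] at h
    refine (smul_eq_zero.1 h.symm).resolve_left fun h0 => ?_
    push_cast at h0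
    have : ((2 * (3 * r) : ℤ) : ℂ) = (3 : ℤ) := by push_cast; linear_combination (2 : ℂ) * h0
    have : 2 * (3 * r) = 3 := by exact_mod_cast this
    omega
  · exact key m hm h3 v

/-- The image of `L_r` is a graded submodule: brackets of `L_r` with `L_m` or `G_m`, `m > 0`, have
index above `r` and act by zero, and `[L_0, L_r] = r L_r`. It is nonzero by injectivity, so it is
all of `V`. -/
theorem opL_surjective (hr : 2 ≤ r) (hV : IsSimple B.space V)
    (hC : ∀ v : V, act CB v = c • v) (hinj : Function.Injective (opL V r))
    (hL : ∀ m, r < m → ∀ v : V, opL V m v = 0) (hG : ∀ m, r ≤ m → ∀ v : V, opG V m v = 0) :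
    Function.Surjective (opL V r) := by
  obtain ⟨hnt, hV⟩ := hV
  have hr0 : 0 ≤ r := by omega
  rw [← LinearMap.range_eq_top]
  refine (hV _ ?_ ?_).resolve_left ?_
  · rintro _ ⟨v, rfl⟩
    obtain ⟨a, ha, b, hb, rfl⟩ := exists_parts v
    rw [map_add]
    have hm : ∀ (i : ZMod 2) (v : V), v ∈ part i → opL V r v ∈ part i := by
      intro i v hv
      have := LieSupermodule.act_mem 0 i (LB r hr0) v (LB_mem r hr0) hv
      rw [zero_add] at this
      rw [opL_of_nonneg hr0]
      exact this
    exact add_mem (Submodule.mem_sup_left ⟨⟨a, rfl⟩, hm 0 a ha⟩)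
      (Submodule.mem_sup_right ⟨⟨b, rfl⟩, hm 1 b hb⟩)
  · rintro ⟨x, hx⟩ _ ⟨v, rfl⟩
    have key : ∀ x (hx : x ∈ B.space), act (⟨x, hx⟩ : B.space) (opL V r v) ∈
        LinearMap.range (opL V r) := by
      intro x hx
      refine Submodule.span_induction (p := fun x hx => act (⟨x, hx⟩ : B.space) (opL V r v) ∈
        LinearMap.range (opL V r)) ?_ ?_ ?_ ?_ hx
      · rintro _ ⟨b, hb, rfl⟩
        rcases b with m | m | _
        · have hm : 0 ≤ m := hb
          change act (LB m hm) _ ∈ _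
          rw [← opL_of_nonneg hm, opL_opL hm hr0]
          refine add_mem ⟨_, rfl⟩ (Submodule.smul_mem _ _ ?_)
          obtain rfl | hm := hm.eq_or_lt
          · rw [zero_add]; exact ⟨_, rfl⟩
          · rw [hL _ (by omega)]; exact zero_mem _
        · have hm : 1 ≤ m := hb
          change act (GB m hm) _ ∈ _
          have h := opL_opG hr0 hm v
          rw [hG (r + m) (by omega), smul_zero, add_zero] at h
          rw [← opG_of_pos hm, ← h]
          exact ⟨_, rfl⟩
        · change act CB _ ∈ _
          rw [hC]
          exact Submodule.smul_mem _ _ ⟨_, rfl⟩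
      · have : act (⟨0, zero_mem _⟩ : B.space) = (0 : V →ₗ[ℂ] V) := map_zero _
        rw [this]; exact zero_mem _
      · intro x y hx hy h1 h2
        have : act (⟨x + y, add_mem hx hy⟩ : B.space) =
          (act (⟨x, hx⟩ : B.space) + act (⟨y, hy⟩ : B.space) : V →ₗ[ℂ] V) :=
            map_add _ (⟨x, hx⟩ : B.space) ⟨y, hy⟩
        rw [this]; exact add_mem h1 h2
      · intro z x hx h1
        have : act (⟨z • x, Submodule.smul_mem _ z hx⟩ : B.space) =
          (z • act (⟨x, hx⟩ : B.space) : V →ₗ[ℂ] V) := map_smul _ z (⟨x, hx⟩ : B.space)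
        rw [this]; exact Submodule.smul_mem _ z h1
    exact key x hx
  · intro h
    obtain ⟨v, hv⟩ := exists_ne (0 : V)
    exact hv (hinj (by rw [LinearMap.range_eq_bot.1 h]; simp))

/-! ### The model and the lowering hypotheses -/

variable (V c) in
/-- The Ramond module `U(N) ⊗ (V ⊕ G_0 V)`. -/
def model : Ramond →ₗ[ℂ] Module.End ℂ (Env N.space ⊗[ℂ] (V × V)) := matched N projN (dbl V c)

theorem dbl_coe (y : N.space) : dbl V c y = 0 := by
  obtain ⟨y, hy⟩ := y
  refine Submodule.span_induction (p := fun y _ => dbl V c y = 0) ?_ ?_ ?_ ?_ hy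
  · rintro _ ⟨b, hb, rfl⟩
    exact dbl_neg c hb
  · simp
  · intro x y _ _ hx hy; simp [hx, hy]
  · intro z x _ hx; simp [hx]

theorem model_isRep :
    IsRep (A := Module.End ℂ (Env N.space ⊗[ℂ] (V × V))) (model V c) :=
  matched_isRep projN_coe dbl_coe projN_mem_part (matched_hyp (dbl V c) (dbl_rel c))

theorem model_one {b : RIdx} (hb : ¬ isNeg b) (v : V × V) :
    model V c (e b) (1 ⊗ₜ v) = 1 ⊗ₜ dbl V c (e b) v := by
  rw [model, matched_one, projN_of_not_isNeg hb]
  simp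

theorem model_L {m : ℤ} (hm : 0 ≤ m) (v : V) :
    model V c (L m) (1 ⊗ₜ (v, 0)) = 1 ⊗ₜ (opL V m v, 0) := by
  have h := model_one (c := c) (b := .L m) (by simpa [isNeg] using hm) (v, 0)
  refine h.trans ?_
  rw [show e (.L m) = L m from rfl, dbl_L]
  simp

theorem model_G {m : ℤ} (hm : 1 ≤ m) (v : V) :
    model V c (G m) (1 ⊗ₜ (v, 0)) = 1 ⊗ₜ (opG V m v, 0) := by
  have h := model_one (c := c) (b := .G m) (by simp [isNeg]; omega) (v, 0)
  refine h.trans ?_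
  rw [show e (.G m) = G m from rfl, dbl_G c (by omega)]
  simp

theorem model_G_zero (v : V) :
    model V c (G 0) (1 ⊗ₜ (v, 0)) = 1 ⊗ₜ (0, v) := by
  have h := model_one (c := c) (b := .G 0) (by simp [isNeg]) (v, 0)
  refine h.trans ?_
  rw [show e (.G 0) = G 0 from rfl, dbl_G_zero]
  simp

theorem model_C (v : V × V) : model V c C (1 ⊗ₜ v) = 1 ⊗ₜ (c • v) := by
  have h := model_one (c := c) (b := .C) (by simp [isNeg]) v
  refine h.trans ?_
  rw [show e .C = C from rfl, dbl_C]

variable (V) in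
/-- The copy `1 ⊗ V` of `V` in the model. -/
def modelBase : V →ₗ[ℂ] Env N.space ⊗[ℂ] (V × V) :=
  TensorProduct.mk ℂ _ _ 1 ∘ₗ LinearMap.inl ℂ V V

theorem modelBase_apply (v : V) : modelBase V v = 1 ⊗ₜ (v, 0) := rfl

theorem model_base (hC : ∀ v : V, act CB v = c • v) (x : B.space) (v : V) :
    model V c x (modelBase V v) = modelBase V (act x v) := by
  obtain ⟨x, hx⟩ := x
  refine Submodule.span_induction (p := fun x hx => model V c x (modelBase V v) =
    modelBase V (act (⟨x, hx⟩ : B.space) v)) ?_ ?_ ?_ ?_ hx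
  · rintro _ ⟨b, hb, rfl⟩
    simp only [modelBase_apply]
    rcases b with m | m | _
    · have hm : 0 ≤ m := hb
      refine (model_L hm v).trans ?_
      rw [opL_of_nonneg hm]; rfl
    · have hm : 1 ≤ m := hb
      refine (model_G hm v).trans ?_
      rw [opG_of_pos hm]; rfl
    · refine (model_C (v, 0)).trans ?_
      rw [Prod.smul_mk, ← hC, smul_zero]; rfl
  · have : act (⟨0, zero_mem _⟩ : B.space) = (0 : V →ₗ[ℂ] V) := map_zero _
    rw [this]; simp
  · intro x y hx hy h1 h2
    have : act (⟨x + y, add_mem hx hy⟩ : B.space) =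
      (act (⟨x, hx⟩ : B.space) + act (⟨y, hy⟩ : B.space) : V →ₗ[ℂ] V) :=
        map_add _ (⟨x, hx⟩ : B.space) ⟨y, hy⟩
    rw [this, map_add, LinearMap.add_apply, h1, h2, LinearMap.add_apply, map_add]
  · intro z x hx h1
    have : act (⟨z • x, Submodule.smul_mem _ z hx⟩ : B.space) =
      (z • act (⟨x, hx⟩ : B.space) : V →ₗ[ℂ] V) := map_smul _ z (⟨x, hx⟩ : B.space)
    rw [this, map_smul, LinearMap.smul_apply, h1, LinearMap.smul_apply, map_smul]

theorem br_mem_N {k : ℤ} (t : Bool) (hk : k < 0) (y : Ramond) (hy : y ∈ N.space) :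
    br (gen t k) y ∈ N.space := by
  refine N.br_mem _ ?_ _ hy
  cases t
  · exact e_mem_N (b := .L k) hk
  · exact e_mem_N (b := .G k) hk

theorem dbl_gen_neg {k : ℤ} (t : Bool) (hk : k < 0) : dbl V c (gen t k) = 0 := by
  cases t
  · exact dbl_neg c (b := .L k) hk
  · exact dbl_neg c (b := .G k) hk

/-- The model satisfies the assumptions of the lowering argument. -/
theorem model_lowering (hr : 2 ≤ r) (hb : Function.Bijective (opL V r))
    (hL : ∀ m, r < m → ∀ v : V, opL V m v = 0) (hG : ∀ m, r ≤ m → ∀ v : V, opG V m v = 0) :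
    ∃ T T', Lowering r (model V c) (LinearMap.range (modelBase V)) T T' := by
  let E := LinearEquiv.ofBijective (opL V r) hb
  have hE : ∀ v, E v = opL V r v := fun v => rfl
  -- `T` applies `L_r` to both copies of `V` and leaves `U(𝔫)` alone, so it is inverted through the
  -- bijectivity of `L_r` on `V`.
  refine ⟨(E.toLinearMap.prodMap E.toLinearMap).lTensor _,
    (E.symm.toLinearMap.prodMap E.symm.toLinearMap).lTensor _, ?_⟩
  constructor
  · exact hr
  · exact model_isRep
  · rintro _ ⟨v, rfl⟩
    refine ⟨c • v, ?_⟩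
    rw [modelBase_apply, modelBase_apply, model_C, Prod.smul_mk, smul_zero]
  · rintro t j hj hl _ ⟨v, rfl⟩
    cases t
    · exact ⟨_, (model_L hj v).symm⟩
    · have : 1 ≤ j := by simp [letter] at hl; omega
      exact ⟨_, (model_G this v).symm⟩
  · rintro j hj _ ⟨v, rfl⟩
    refine (model_L (by omega) v).trans ?_
    rw [hL j hj]
    exact map_zero (modelBase V)
  · rintro j hj _ ⟨v, rfl⟩
    refine (model_G (by omega) v).trans ?_
    rw [hG j hj]
    exact map_zero (modelBase V)
  · intro t j hj w hw
    by_cases hj0 : j = 0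
    · obtain ⟨v, rfl⟩ := hw hj0
      obtain ⟨rfl, rfl⟩ := hj.resolve_left (by omega)
      rw [modelBase_apply]
      simp only [gen, model_G_zero, LinearMap.lTensor_tmul, LinearMap.prodMap_apply, map_zero]
    · have hj' : j < 0 := hj.resolve_right fun h => hj0 h.1
      exact matched_lTensor_comm projN_coe dbl_coe (gen_mem t j) (br_mem_N t hj') _
        (fun v => by rw [dbl_gen_neg t hj']; simp; rfl) w
  · rintro _ ⟨v, rfl⟩
    rw [modelBase_apply, model_L (by omega)]
    simp [hE]
  · rintro _ ⟨v, rfl⟩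
    refine ⟨E.symm v, ?_⟩
    simp [modelBase_apply]
  · intro w
    rw [← LinearMap.comp_apply, ← LinearMap.lTensor_comp]
    convert LinearMap.id_apply w
    rw [← LinearMap.lTensor_id]
    congr 1
    ext v <;> simp
  · intro w
    rw [← LinearMap.comp_apply, ← LinearMap.lTensor_comp]
    convert LinearMap.id_apply w
    rw [← LinearMap.lTensor_id]
    congr 1
    ext v <;> simp

theorem model_generated (hyp : ∃ T T', Lowering r (model V c) (LinearMap.range (modelBase V)) T T')
    (w : Env N.space ⊗[ℂ] (V × V)) :
    ∃ n : ℕ, w ∈ filt (model V c) (LinearMap.range (modelBase V)) n n := by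
  obtain ⟨T, T', hyp⟩ := hyp
  have hr := hyp.two_le
  have hadd : ∀ a b, (∃ n : ℕ, a ∈ filt (model V c) (LinearMap.range (modelBase V)) n n) →
      (∃ n : ℕ, b ∈ filt (model V c) (LinearMap.range (modelBase V)) n n) →
      ∃ n : ℕ, a + b ∈ filt (model V c) (LinearMap.range (modelBase V)) n n := by
    rintro a b ⟨n, hn⟩ ⟨m, hm⟩
    exact ⟨max n m, add_mem (Lowering.filt_mono (by push_cast; omega) hn)
      (Lowering.filt_mono (by push_cast; omega) hm)⟩
  have hsmul : ∀ (z : ℂ) a, (∃ n : ℕ, a ∈ filt (model V c) (LinearMap.range (modelBase V)) n n) →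
      ∃ n : ℕ, z • a ∈ filt (model V c) (LinearMap.range (modelBase V)) n n :=
    fun z a ⟨n, hn⟩ => ⟨n, Submodule.smul_mem _ _ hn⟩
  induction w using Env.tensor_induct with
  | h1 v =>
    obtain ⟨v, v'⟩ := v
    have h : (1 : Env N.space) ⊗ₜ[ℂ] (v, v') = modelBase V v + model V c (G 0) (modelBase V v') := by
      rw [modelBase_apply, modelBase_apply, model_G_zero, ← TensorProduct.tmul_add]
      simp
    have h1 : ∀ v, Word (model V c) (LinearMap.range (modelBase V)) 0 0 (modelBase V v) :=
      fun v => .base _ ⟨v, rfl⟩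
    rw [h]
    refine hadd _ _ ⟨0, Lowering.word_mem (h1 v) (by simp)⟩
      ⟨1, Lowering.word_mem (.step true 0 (.inr ⟨rfl, rfl⟩) _ _ _ (h1 v') fun _ => rfl) ?_⟩
    simp [wt]
  | hadd a b ha hb => exact hadd a b ha hb
  | hsmul z a ha => exact hsmul z a ha
  | hι i x hx w ih =>
    rw [← matched_of_mem (π := projN) (σ := dbl V c) projN_coe dbl_coe]
    change ∃ n : ℕ, model V c x w ∈ _
    obtain ⟨x, hx'⟩ := x
    clear hx
    refine Submodule.span_induction (p := fun x _ => ∃ n : ℕ, model V c x w ∈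
      filt (model V c) (LinearMap.range (modelBase V)) n n) ?_ ?_ ?_ ?_ hx'
    · obtain ⟨n, hn⟩ := ih
      have key : ∀ t j, j < 0 → ∃ n : ℕ, model V c (gen t j) w ∈
          filt (model V c) (LinearMap.range (modelBase V)) n n := by
        intro t j hj
        have := Lowering.neg_letter_mem (t := t) hj hn
        have hw : wt j = -2 * j := by simp [wt, hj.ne]
        exact ⟨n + (-2 * j).toNat, Lowering.filt_mono (by push_cast; omega) this⟩
      rintro _ ⟨b, hb, rfl⟩
      rcases b with m | m | _
      · exact key false m hb
      · exact key true m hb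
      · exact absurd hb id
    · exact ⟨0, by simp⟩
    · intro x y _ _ h1 h2
      rw [map_add, LinearMap.add_apply]
      exact hadd _ _ h1 h2
    · intro z x _ h1
      rw [map_smul, LinearMap.smul_apply]
      exact hsmul _ _ h1

/-! ### Embedding the induced module in the model -/

variable (V) in
/-- The map `(v, v') ↦ 1 ⊗ v + G_0 ⊗ v'` into the induced module. -/
def dblBase : V × V →ₗ[ℂ] Ind B V :=
  LinearMap.coprod (Ind.base B V) (act (G 0) ∘ₗ Ind.base B V)

theorem dblBase_apply (v : V × V) :
    dblBase V v = Ind.base B V v.1 + act (G 0) (Ind.base B V v.2) := rfl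

theorem act_L_base {m : ℤ} (hm : 0 ≤ m) (v : V) :
    act (L m) (Ind.base B V v) = Ind.base B V (opL V m v) := by
  rw [opL_of_nonneg hm]; exact Ind.act_base B (LB m hm) v

theorem act_G_base {m : ℤ} (hm : 1 ≤ m) (v : V) :
    act (G m) (Ind.base B V v) = Ind.base B V (opG V m v) := by
  rw [opG_of_pos hm]; exact Ind.act_base B (GB m hm) v

/-- The commutations past `G_0` that dictated `dblBasis` hold in the induced module. This is the
compatibility needed to map the model to it. -/
theorem act_dblBase (hC : ∀ v : V, act CB v = c • v) {b : RIdx} (hb : ¬ isNeg b) (v : V × V) :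
    act (e b) (dblBase V v) = dblBase V (dbl V c (e b) v) := by
  have hrep := act_isRep (𝔤 := Ramond) (Ind B V)
  have hcomm : ∀ (a b : RIdx) (w : Ind B V), act (e a) (act (e b) w) =
      koszul (par a) (par b) • act (e b) (act (e a) w) + act (brLin (e a) (e b)) w :=
    fun a b w => LinearMap.congr_fun (hrep _ _ _ _ (single_mem a) (single_mem b)) w
  have hCb : ∀ v : V, act C (Ind.base B V v) = c • Ind.base B V v := fun v => by
    rw [← map_smul, ← hC]; exact Ind.act_base B CB v
  rcases b with m | m | _
  · have hm : 0 ≤ m := by simpa [isNeg] using hb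
    have h := hcomm (.L m) (.G 0) (Ind.base B V v.2)
    change act (L m) (act (G 0) _) = koszul 0 1 • act (G 0) (act (L m) _) +
      act (brLin (L m) (G 0)) _ at h
    change act (L m) _ = dblBase V (dbl V c (L m) v)
    rw [dbl_L, dblBase_apply, dblBase_apply, map_add, h, act_L_base hm, act_L_base hm, brLin_L_G,
      map_smul, add_zero, LinearMap.smul_apply]
    obtain rfl | hm := hm.eq_or_lt
    · simp [koszul]
    · have hm1 : 1 ≤ m := hm
      rw [act_G_base hm1, map_sub, map_smul]
      simp only [koszul]
      simp
      module
  · have hm : 0 ≤ m := by simpa [isNeg] using hb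
    have h := hcomm (.G m) (.G 0) (Ind.base B V v.2)
    change act (G m) (act (G 0) _) = koszul 1 1 • act (G 0) (act (G m) _) +
      act (brLin (G m) (G 0)) _ at h
    change act (G m) _ = dblBase V (dbl V c (G m) v)
    have hk : koszul 1 1 = -1 := by simp [koszul]
    obtain rfl | hm := hm.eq_or_lt
    · rw [hk, brLin_G_G, neg_one_smul, ← sub_eq_iff_eq_add', sub_neg_eq_add, ← two_smul ℂ] at h
      have h2 : act (G 0) (act (G 0) (Ind.base B V v.2)) =
          -Ind.base B V (opL V 0 v.2) - (c / 24) • Ind.base B V v.2 := by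
        refine (smul_right_injective _ (two_ne_zero' ℂ)) ?_
        refine h.trans ?_
        simp only [map_add, map_smul, LinearMap.add_apply, LinearMap.smul_apply, hCb,
          act_L_base le_rfl, add_zero, if_true]
        push_cast
        module
      rw [dbl_G_zero, dblBase_apply, dblBase_apply, map_add, h2, map_sub, map_neg, map_smul]
      abel
    · rw [dbl_G c hm.ne', dblBase_apply, dblBase_apply, map_add, h, act_G_base hm, act_G_base hm,
        brLin_G_G, hk, if_neg (by omega), zero_smul, add_zero, add_zero, map_smul,
        LinearMap.smul_apply, act_L_base hm.le, map_sub, map_smul, map_neg, map_neg]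
      module
  · have h := hcomm .C (.G 0) (Ind.base B V v.2)
    change act C (act (G 0) _) = koszul 0 1 • act (G 0) (act C _) + act (brLin C (G 0)) _ at h
    change act C _ = dblBase V (dbl V c C v)
    rw [dbl_C, dblBase_apply, map_add, h, hCb, hCb, brLin_C_left, map_smul, map_zero, map_smul,
      dblBase_apply]
    simp [koszul]

theorem act_dblBase_eq (hC : ∀ v : V, act CB v = c • v) (z : Ramond) (v : V × V) :
    act z (dblBase V v) = act (projN z : Ramond) (dblBase V v) + dblBase V (dbl V c z v) := by
  induction z using Finsupp.induction_linear with
  | zero => simp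
  | add a b ha hb =>
    simp only [map_add, LinearMap.add_apply, Submodule.coe_add, ha, hb]
    abel
  | single b t =>
    have ht : Finsupp.single b t = t • e b := by simp
    have h : act (e b) (dblBase V v) =
        act (projN (e b) : Ramond) (dblBase V v) + dblBase V (dbl V c (e b) v) := by
      by_cases hb : isNeg b
      · rw [projN_of_isNeg hb, dbl_neg c hb]; simp
      · rw [projN_of_not_isNeg hb, act_dblBase hC hb]; simp
    rw [ht]
    simp only [map_smul, LinearMap.smul_apply, Submodule.coe_smul]
    rw [h, smul_add]

/-- The two universal properties give intertwiners `Ψ` into the model and `Φ` back, and `Φ ∘ Ψ` is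
the identity because it fixes the generating space `V`. Injectivity of `Ψ` takes the place of PBW:
the image of an invariant subspace under `Ψ` meets `1 ⊗ V`, and this pulls back. -/
theorem ind_isSimple (hr : 2 ≤ r) (hV : IsSimple B.space V) (hC : ∀ v : V, act CB v = c • v)
    (hinj : Function.Injective (opL V r)) (hL : ∀ m, r < m → ∀ v : V, opL V m v = 0)
    (hG : ∀ m, r ≤ m → ∀ v : V, opG V m v = 0) : IsSimple Ramond (Ind B V) := by
  have hlow := model_lowering (c := c) hr ⟨hinj, opL_surjective hr hV hC hinj hL hG⟩ hL hG
  have hgen := model_generated hlow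
  obtain ⟨T, T', hlow⟩ := hlow
  obtain ⟨Ψ, hΨ1, hΨ2⟩ := Ind.exists_hom B model_isRep (modelBase V) (model_base hC)
  obtain ⟨Φ, hΦ1, hΦ2⟩ := exists_matched_hom (act_isRep (𝔤 := Ramond) (Ind B V)) (dblBase V)
    (act_dblBase_eq hC)
  have hu : ∀ (u : Env Ramond) w, Φ (Ψ w) = w → Φ (Ψ (u • w)) = u • w := by
    intro u
    induction u using Env.induct with
    | h1 z => intro w hw; rw [algebraMap_smul, map_smul, map_smul, hw]
    | hι x =>
      intro w hw
      change Φ (Ψ (act x w)) = act x w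
      rw [hΨ2]
      exact (hΦ2 _ _).trans (by rw [hw])
    | hmul a b ha hb => intro w hw; rw [mul_smul]; exact ha _ (hb _ hw)
    | hadd a b ha hb => intro w hw; rw [add_smul, map_add, map_add, ha _ hw, hb _ hw]
  have hinv : ∀ w, Φ (Ψ w) = w := by
    intro w
    induction w using Ind.induct with
    | h u v =>
      refine hu u _ ?_
      rw [hΨ1, modelBase_apply, hΦ1, dblBase_apply]
      simp
    | hadd a b ha hb => rw [map_add, map_add, ha, hb]
  have hΨi : Function.Injective Ψ := Function.LeftInverse.injective hinv
  have hbase : ∀ v : V, modelBase V v = 0 → v = 0 := by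
    intro v hv
    have := Env.one_tmul_eq_zero_iff.1 hv
    exact congrArg Prod.fst this
  refine Ind.isSimple B hV (fun v hv => hbase v ?_) fun M hM hne => ?_
  · rw [← hΨ1, hv, map_zero]
  · obtain ⟨_, ⟨v, rfl⟩, ⟨w, hw, hwv⟩, hv⟩ := hlow.exists_ne_zero_mem hgen (M.map Ψ)
      (by
        rintro x _ ⟨w, hw, rfl⟩
        exact ⟨act x w, hM x w hw, hΨ2 x w⟩)
      (fun h => hne ((Submodule.eq_bot_iff _).2 fun w hw => hΨi (by
        rw [map_zero, ← Submodule.mem_bot ℂ, ← h]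
        exact ⟨w, hw, rfl⟩)))
    refine ⟨v, ?_, ?_⟩
    · rw [← hΨ1] at hwv
      rwa [← hΨi hwv]
    · rintro rfl
      exact hv (map_zero _)

end Ramond

end SuperLie

end

theorem theorem3p4 (c : ℂ) (r : ℤ) (hr : 2 ≤ r)
    (V : Type*) [AddCommGroup V] [Module ℂ V] [SuperLie.SuperSpace V]
    [SuperLie.LieSupermodule SuperLie.Ramond.B.space V]
    (hV : SuperLie.IsSimple SuperLie.Ramond.B.space V)
    (hC : ∀ v : V, SuperLie.act SuperLie.Ramond.CB v = c • v)
    (hinj : Function.Injective fun v : V =>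
      SuperLie.act (SuperLie.Ramond.LB r (by omega)) v)
    (hL : ∀ (m : ℤ) (hm : r < m) (v : V),
      SuperLie.act (SuperLie.Ramond.LB m (by omega)) v = 0)
    (hG : ∀ v : V, SuperLie.act (SuperLie.Ramond.GB r (by omega)) v = 0) :
    SuperLie.IsSimple SuperLie.Ramond (SuperLie.Ind SuperLie.Ramond.B V) := by
  refine SuperLie.Ramond.ind_isSimple hr hV hC (fun a b hab => hinj ?_)
    (fun m hm v => SuperLie.Ramond.opL_of_gt (fun m hm _ v => hL m hm v) hm v)
    (fun m hm v => SuperLie.Ramond.opG_of_ge hr (fun v => ?_) hm v)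
  · simpa only [SuperLie.Ramond.opL_of_nonneg (show 0 ≤ r by omega)] using hab
  · rw [SuperLie.Ramond.opG_of_pos (by omega), hG]
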